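/- Let $n\ge 1$ and $t\ge 1$. For a probability measure $\nu$ on the unitary group $U(2^n)$ of $n$ qubits, let $$M(\nu,t)=\int U^{\otimes t}\otimes \overline{U}^{\otimes t}\,d\nu(U),\qquad g(\nu,t)=\big\|M(\nu,t)-M(\mu_H,t)\big\|_\infty ,$$ where $\mu_H$ is the Haar probability measure on $U(2^n)$ and $\|\cdot\|_\infty$ is the Schatten $\infty$-norm (operator norm). Let $\mathcal P_n=\{\,i^kP_1\otimes\cdots\otimes P_n : k\in\mathbb Z,\ P_j\in\{\mathbb 1,X,Y,Z\}\,\}$ be the $n$-qubit Pauli group and $$\mathrm{Cl}(n)=\{U\in U(2^n)\;:\;U \text{ has entries in } \mathbb Q[i] \text{ and } U\mathcal P_nU^\dagger\subseteq\mathcal P_n\}$$ the Clifford group. Let $\mu_{\mathrm{Cl}}$ be the uniform measure on the Clifford group, for any convention about global phases: $\mu_{\mathrm{Cl}}$ is the Haar probability measure (the uniform distribution, if $G$ is finite) of a compact subgroup $G\le U(2^n)$ such that every element of $G$ is a phase times an element of $\mathrm{Cl}(n)$ and every element of $\mathrm{Cl}(n)$ is a phase times an element of $G$. Let $\mu_{H,1}$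 be the Haar probability measure on the subgroup $U(2)\otimes\mathbb 1_{n-1}$ (unitaries acting on the first qubit only), and let $$\sigma=\mu_{\mathrm{Cl}}*\mu_{H,1}*\mu_{\mathrm{Cl}} .$$ Then $$g(\sigma,t)\le 1-\frac32\,\frac{1}{2^{2n}-1}.$$ -/

import Mathlib

open MeasureTheory
open scoped Matrix Kronecker

noncomputable section

/-! ### Tensor products of square matrices -/

/-- The tensor product `⨂ k, A k` of a family of square matrices, in the product basis
`|x⟩ = ⨂ k, |x k⟩` indexed by `x : κ → ι`. -/
def tensor {κ ι : Type} [Fintype κ] (A : κ → Matrix ι ι ℂ) : Matrix (κ → ι) (κ → ι) ℂ :=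
  Matrix.of fun x y => ∏ k, A k (x k) (y k)

/-- The tensor power `A ⊗ ⋯ ⊗ A` with `t` factors. -/
def tensorPow {ι : Type} (t : ℕ) (A : Matrix ι ι ℂ) :
    Matrix (Fin t → ι) (Fin t → ι) ℂ :=
  tensor fun _ : Fin t => A

theorem tensor_mul {κ ι : Type} [Fintype κ] [DecidableEq κ] [Fintype ι]
    (A B : κ → Matrix ι ι ℂ) :
    tensor A * tensor B = tensor fun k => A k * B k := by
  ext x y
  simp only [tensor, Matrix.mul_apply, Matrix.of_apply, ← Finset.prod_mul_distrib]
  rw [Finset.prod_univ_sum, Fintype.piFinset_univ]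

theorem tensor_one {κ ι : Type} [Fintype κ] [DecidableEq ι] :
    tensor (fun _ : κ => (1 : Matrix ι ι ℂ)) = 1 := by
  classical
  ext x y
  simp only [tensor, Matrix.of_apply, Matrix.one_apply, Finset.prod_ite_zero]
  simp [funext_iff]

theorem tensor_star {κ ι : Type} [Fintype κ] (A : κ → Matrix ι ι ℂ) :
    star (tensor A) = tensor fun k => star (A k) := by
  ext x y
  simp [tensor, Matrix.star_apply]

theorem tensor_smul {κ ι : Type} [Fintype κ] (c : κ → ℂ) (A : κ → Matrix ι ι ℂ) :
    tensor (fun k => c k • A k) = (∏ k, c k) • tensor A := by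
  ext x y
  simp [tensor, Finset.prod_mul_distrib]

/-! ### Unitary groups as compact groups -/

/-- The unitary group of matrices carries its Borel σ-algebra. -/
instance unitaryGroup_measurableSpace (ι : Type) [Fintype ι] [DecidableEq ι] :
    MeasurableSpace (Matrix.unitaryGroup ι ℂ) := borel _

instance unitaryGroup_borelSpace (ι : Type) [Fintype ι] [DecidableEq ι] :
    BorelSpace (Matrix.unitaryGroup ι ℂ) := ⟨rfl⟩

instance unitaryGroup_secondCountable (ι : Type) [Fintype ι] [DecidableEq ι] :
    SecondCountableTopology (Matrix.unitaryGroup ι ℂ) :=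
  haveI : SecondCountableTopology (Matrix ι ι ℂ) :=
    inferInstanceAs (SecondCountableTopology (ι → ι → ℂ))
  Topology.IsEmbedding.subtypeVal.secondCountableTopology

instance unitaryGroup_compactSpace (ι : Type) [Fintype ι] [DecidableEq ι] :
    CompactSpace (Matrix.unitaryGroup ι ℂ) := by
  refine isCompact_iff_compactSpace.mp ?_
  have hb : IsCompact (Set.pi Set.univ fun _ : ι => Set.pi Set.univ fun _ : ι =>
      Metric.closedBall (0 : ℂ) 1) :=
    isCompact_univ_pi fun _ => isCompact_univ_pi fun _ => isCompact_closedBall 0 1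
  refine IsCompact.of_isClosed_subset (X := Matrix ι ι ℂ) hb ?_ ?_
  · have h : ((Matrix.unitaryGroup ι ℂ : Submonoid (Matrix ι ι ℂ)) : Set (Matrix ι ι ℂ)) =
        {A | A * star A = 1} := by
      ext A
      exact Matrix.mem_unitaryGroup_iff
    rw [h]
    exact isClosed_eq (by fun_prop) continuous_const
  · intro A hA i _ j _
    simpa using entry_norm_bound_of_unitary hA i j

/-- The Haar probability measure of a compact group. For a finite group (with the discrete
topology) it is the uniform distribution. -/
def haarProb (G : Type) [Group G] [TopologicalSpace G] [IsTopologicalGroup G] [CompactSpace G]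
    [MeasurableSpace G] [BorelSpace G] : Measure G :=
  Measure.haarMeasure ⊤

/-! ### Qubits, the Pauli group and the Clifford group -/

/-- The unitary group `U(2^n)` of `n` qubits; computational basis vectors are indexed by
`x : Fin n → Fin 2`. -/
abbrev QubitUnitary (n : ℕ) : Type := Matrix.unitaryGroup (Fin n → Fin 2) ℂ

/-- The single-qubit Pauli matrices `1, X, Y, Z`. -/
def pauli : Fin 4 → Matrix (Fin 2) (Fin 2) ℂ :=
  ![1, !![0, 1; 1, 0], !![0, -Complex.I; Complex.I, 0], !![1, 0; 0, -1]]

theorem pauli_star (a : Fin 4) : star (pauli a) = pauli a := by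
  fin_cases a <;> ext i j <;> fin_cases i <;> fin_cases j <;>
    simp [pauli, Matrix.star_apply]

theorem pauli_mul_self (a : Fin 4) : pauli a * pauli a = 1 := by
  fin_cases a <;> ext i j <;> fin_cases i <;> fin_cases j <;>
    simp [pauli, Matrix.mul_apply, Fin.sum_univ_two]

theorem pauli_mul (a b : Fin 4) :
    ∃ (k : ℕ) (c : Fin 4), pauli a * pauli b = Complex.I ^ k • pauli c := by
  have key : ∀ (k : ℕ) (c : Fin 4), pauli a * pauli b = Complex.I ^ k • pauli c →
      ∃ (k : ℕ) (c : Fin 4), pauli a * pauli b = Complex.I ^ k • pauli c :=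
    fun k c h => ⟨k, c, h⟩
  have h3 : Complex.I ^ 3 = -Complex.I := by
    rw [pow_succ, Complex.I_sq]; simp
  fin_cases a <;> fin_cases b
  · exact key 0 0 (by simp [pauli])
  · exact key 0 1 (by simp [pauli])
  · exact key 0 2 (by simp [pauli])
  · exact key 0 3 (by simp [pauli])
  · exact key 0 1 (by simp [pauli])
  · exact key 0 0 (by simpa [pauli] using pauli_mul_self 1)
  · exact key 1 3 (by
      ext i j; fin_cases i <;> fin_cases j <;>
        simp [pauli, Matrix.mul_apply, Fin.sum_univ_two])
  · exact key 3 2 (by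
      ext i j; fin_cases i <;> fin_cases j <;>
        simp [pauli, Matrix.mul_apply, Fin.sum_univ_two, h3])
  · exact key 0 2 (by simp [pauli])
  · exact key 3 3 (by
      ext i j; fin_cases i <;> fin_cases j <;>
        simp [pauli, Matrix.mul_apply, Fin.sum_univ_two, h3])
  · exact key 0 0 (by simpa [pauli] using pauli_mul_self 2)
  · exact key 1 1 (by
      ext i j; fin_cases i <;> fin_cases j <;>
        simp [pauli, Matrix.mul_apply, Fin.sum_univ_two])
  · exact key 0 3 (by simp [pauli])
  · exact key 1 2 (by
      ext i j; fin_cases i <;> fin_cases j <;>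
        simp [pauli, Matrix.mul_apply, Fin.sum_univ_two])
  · exact key 3 1 (by
      ext i j; fin_cases i <;> fin_cases j <;>
        simp [pauli, Matrix.mul_apply, Fin.sum_univ_two, h3])
  · exact key 0 0 (by simpa [pauli] using pauli_mul_self 3)

/-- The `n`-qubit Pauli group: all `i^k P₁ ⊗ ⋯ ⊗ Pₙ` with `Pⱼ ∈ {1, X, Y, Z}`. -/
def pauliGroup (n : ℕ) : Subgroup (QubitUnitary n) where
  carrier := {P | ∃ (k : ℕ) (a : Fin n → Fin 4),
    (P : Matrix (Fin n → Fin 2) (Fin n → Fin 2) ℂ) =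
      Complex.I ^ k • tensor fun j => pauli (a j)}
  one_mem' := ⟨0, fun _ => 0, by simpa [pauli] using (tensor_one (κ := Fin n) (ι := Fin 2)).symm⟩
  mul_mem' := by
    rintro P Q ⟨k, a, hP⟩ ⟨l, b, hQ⟩
    choose m c h using fun j => pauli_mul (a j) (b j)
    refine ⟨k + l + ∑ j, m j, c, ?_⟩
    simp only [Submonoid.coe_mul, hP, hQ, smul_mul_smul_comm, tensor_mul, h, tensor_smul,
      smul_smul, pow_add, Finset.prod_pow_eq_pow_sum]
  inv_mem' := by
    rintro P ⟨k, a, hP⟩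
    refine ⟨3 * k, a, ?_⟩
    have h3 : star Complex.I = Complex.I ^ 3 := by
      rw [pow_succ, Complex.I_sq]; simp
    rw [Matrix.UnitaryGroup.inv_val, hP, star_smul, tensor_star, star_pow, h3, ← pow_mul]
    simp only [pauli_star]

theorem pauliGroup_finite (n : ℕ) : (pauliGroup n : Set (QubitUnitary n)).Finite := by
  have hf : (Set.range fun p : Fin 4 × (Fin n → Fin 4) =>
      Complex.I ^ (p.1 : ℕ) • tensor fun j => pauli (p.2 j)).Finite := Set.finite_range _
  refine (hf.preimage Subtype.val_injective.injOn).subset ?_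
  rintro P ⟨k, a, hP⟩
  refine ⟨(⟨k % 4, Nat.mod_lt _ (by norm_num)⟩, a), ?_⟩
  have : Complex.I ^ (k % 4) = Complex.I ^ k := by
    conv_rhs => rw [← Nat.mod_add_div k 4, pow_add, pow_mul, Complex.I_pow_four, one_pow, mul_one]
  simp only [this]
  exact hP.symm

/-- The ring `ℚ[i]` inside `ℂ`. -/
abbrev gaussianRat : Subalgebra ℚ ℂ := Algebra.adjoin ℚ {Complex.I}

theorem gaussianRat_star {z : ℂ} (hz : z ∈ gaussianRat) : star z ∈ gaussianRat := by
  induction hz using Algebra.adjoin_induction with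
  | mem x hx =>
    rw [Set.mem_singleton_iff.mp hx]
    simp
  | algebraMap r => simpa using gaussianRat.algebraMap_mem r
  | add x y _ _ hx hy => simpa using add_mem hx hy
  | mul x y _ _ hx hy => simpa using mul_mem hx hy

/-- The Clifford group `Cl(n) = {U ∈ U(2^n, ℚ[i]) | U 𝒫ₙ U† ⊆ 𝒫ₙ}`. -/
def cliffordGroup (n : ℕ) : Subgroup (QubitUnitary n) where
  carrier := {U | (∀ x y, (U : Matrix (Fin n → Fin 2) (Fin n → Fin 2) ℂ) x y ∈ gaussianRat) ∧
    ∀ P ∈ pauliGroup n, U * P * U⁻¹ ∈ pauliGroup n}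
  one_mem' := by
    refine ⟨fun x y => ?_, fun P hP => by simpa using hP⟩
    rw [Submonoid.coe_one, Matrix.one_apply]
    split_ifs
    exacts [one_mem _, zero_mem _]
  mul_mem' := by
    rintro U V ⟨hU, hU'⟩ ⟨hV, hV'⟩
    refine ⟨fun x y => ?_, fun P hP => ?_⟩
    · rw [Submonoid.coe_mul, Matrix.mul_apply]
      exact sum_mem fun z _ => mul_mem (hU x z) (hV z y)
    · simpa [mul_assoc] using hU' _ (hV' P hP)
  inv_mem' := by
    rintro U ⟨hU, hU'⟩
    refine ⟨fun x y => ?_, fun P hP => ?_⟩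
    · rw [Matrix.UnitaryGroup.inv_val, Matrix.star_apply]
      exact gaussianRat_star (hU y x)
    · have : Finite (pauliGroup n) := (pauliGroup_finite n).to_subtype
      have hinj : Function.Injective
          (fun Q : pauliGroup n => (⟨U * Q * U⁻¹, hU' Q Q.2⟩ : pauliGroup n)) := by
        intro Q R h
        have h' : U * Q.1 * U⁻¹ = U * R.1 * U⁻¹ := congrArg Subtype.val h
        exact Subtype.ext (mul_left_cancel (mul_right_cancel h'))
      obtain ⟨Q, hQ⟩ := Finite.surjective_of_injective hinj ⟨P, hP⟩
      have hQ' : U * Q * U⁻¹ = P := congrArg Subtype.val hQ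
      have : U⁻¹ * P * U⁻¹⁻¹ = Q := by
        rw [← hQ']; group
      rw [this]
      exact Q.2

/-- Two groups of unitaries agree up to global phases: each element of either is a phase times
an element of the other. -/
def EqModPhases {n : ℕ} (G K : Subgroup (QubitUnitary n)) : Prop :=
  (∀ U ∈ G, ∃ V ∈ K, ∃ c : Circle, U.1 = (c : ℂ) • V.1) ∧
    ∀ V ∈ K, ∃ U ∈ G, ∃ c : Circle, V.1 = (c : ℂ) • U.1

/-! ### The measures of the walk -/

/-- The uniform (Haar probability) measure of a compact subgroup, as a measure on `U(2^n)`. -/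
def uniformMeasure {n : ℕ} (G : Subgroup (QubitUnitary n)) [CompactSpace G] :
    Measure (QubitUnitary n) :=
  (haarProb G).map Subtype.val

/-- The unitary that acts as `V` on qubit `i` and as the identity on all others. -/
def onQubit {n : ℕ} (i : Fin n) (V : Matrix.unitaryGroup (Fin 2) ℂ) : QubitUnitary n :=
  ⟨tensor (Function.update (fun _ => 1) i V.1), by
    rw [Matrix.mem_unitaryGroup_iff, tensor_star, tensor_mul, ← tensor_one]
    congr 1
    funext j
    rcases eq_or_ne j i with rfl | h
    · simp
    · simp [h]⟩

/-- The Haar measure on the group `U(2)` acting on qubit `i`, as a measure on `U(2^n)`. -/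
def singleQubitHaar {n : ℕ} (i : Fin n) : Measure (QubitUnitary n) :=
  (haarProb (Matrix.unitaryGroup (Fin 2) ℂ)).map (onQubit i)

/-- One step `μ_G * μ_{H,1} * μ_G` of the auxiliary walk: a uniform element of `G`, then a Haar
random unitary on the first qubit, then a uniform element of `G`, all independent. -/
def auxWalk {n : ℕ} (hn : 1 ≤ n) (G : Subgroup (QubitUnitary n)) [CompactSpace G] :
    Measure (QubitUnitary n) :=
  uniformMeasure G ∗ₘ singleQubitHaar ⟨0, hn⟩ ∗ₘ uniformMeasure G

/-! ### Moment operators -/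

/-- The moment operator `M(ν, t) = ∫ U^{⊗t} ⊗ conj(U)^{⊗t} dν(U)`, as an entrywise integral. -/
def momentOp {n : ℕ} (ν : Measure (QubitUnitary n)) (t : ℕ) :
    Matrix ((Fin t → Fin n → Fin 2) × (Fin t → Fin n → Fin 2))
      ((Fin t → Fin n → Fin 2) × (Fin t → Fin n → Fin 2)) ℂ :=
  Matrix.of fun x y => ∫ U, (tensorPow t U.1 ⊗ₖ tensorPow t (U.1.map star)) x y ∂ν

/-- The Schatten `∞`-norm, i.e. the operator norm with respect to the Euclidean norm. -/
def schattenInfNorm {ι : Type} [Fintype ι] [DecidableEq ι] (A : Matrix ι ι ℂ) : ℝ :=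
  ‖Matrix.toEuclideanCLM (𝕜 := ℂ) A‖

/-- `g(ν, t) = ‖M(ν, t) - M(μ_H, t)‖_∞`, where `μ_H` is the Haar measure on `U(2^n)`. -/
def momentGap {n : ℕ} (ν : Measure (QubitUnitary n)) (t : ℕ) : ℝ :=
  schattenInfNorm (momentOp ν t - momentOp (haarProb (QubitUnitary n)) t)

end

/-! Write π(U) = `mixedPow t U`, a unitary representation of U(2^n). The moment operators A, B, H of
the Clifford, single-qubit and full Haar measures are the orthogonal projections onto the respective
invariant vectors, and H lies below A and B. Convolution becomes multiplication, so the gap is the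
norm of the self-adjoint operator T = ABA - H.

The bound comes from a Casimir element. For each Pauli string a let D_a = `mixedDeriv t (pauliString
a)`, the tangent operator of π, and C = ∑ D_a². Since ∑ P_a ⊗ P_a is a multiple of the swap, which
commutes with U ⊗ U, C commutes with every π(U) (`IsSwapFamily.commute_casimir`), hence with A, B, H
and T. If T ≠ 0, take a common eigenvector v of T and C, with T-eigenvalue of modulus ‖T‖ and
C-eigenvalue c. Then Av = v, Hv = 0 and ‖Bv‖² = ‖T‖‖v‖², and w = v - Bv is killed by B, has ‖w‖² =
(1 - ‖T‖)‖v‖² and satisfies Cw = cw.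

Now c‖v‖² = ∑ ‖D_a v‖². The Clifford group is transitive up to conjugation on the 4^n - 1 nontrivial
strings (`exists_clifford_conj_of_ne_zero`) and fixes v, so all nontrivial terms are equal
(`norm_mixedDeriv_pauliString_eq`), while D_0 = 0. The three nontrivial strings supported on the
first qubit have D_a B = 0 (`mixedDeriv_siteOp_mul_momentOp`), so D_a w = D_a v, and these three
terms sum to at most c‖w‖². Hence 3/(4^n - 1) · c‖v‖² ≤ c(1 - ‖T‖)‖v‖². Finally c > 0: otherwise all
D_a v vanish, v is invariant under all unitaries (`IsSwapFamily.mixedPow_mulVec`) and v = Hv = 0.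
This proves the bound with 3 in place of 3/2. -/

noncomputable section

/-! ### Alternating projections and the abstract Casimir bound -/

/-- A nonzero self-adjoint operator `T` on a finite-dimensional space and an operator `C` commuting
with it have a common eigenvector, for an eigenvalue of `T` of absolute value `‖T‖`. -/
theorem exists_common_eigenvector_norm_eq {E : Type*} [NormedAddCommGroup E]
    [InnerProductSpace ℂ E] [FiniteDimensional ℂ E] {T C : E →L[ℂ] E} (hT : IsSelfAdjoint T)
    (hT0 : T ≠ 0) (hTC : Commute C T) :
    ∃ (v : E) (l c : ℂ), v ≠ 0 ∧ T v = l • v ∧ C v = c • v ∧ ‖l‖ = ‖T‖ := by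
  have : CompleteSpace E := FiniteDimensional.complete ℂ E
  have : Nontrivial (E →L[ℂ] E) := ⟨⟨T, 0, hT0⟩⟩
  obtain ⟨l, hl, hln⟩ := spectrum.exists_nnnorm_eq_spectralRadius T
  rw [hT.spectralRadius_eq_nnnorm] at hln
  have hln' : ‖l‖ = ‖T‖ := by
    have := ENNReal.coe_injective hln
    exact congrArg NNReal.toReal this
  have hspec : l ∈ spectrum ℂ (T : E →ₗ[ℂ] E) := by
    rw [← AlgEquiv.spectrum_eq (Module.End.toContinuousLinearMap E)]
    exact hl
  have hev := Module.End.hasEigenvalue_iff_mem_spectrum.mpr hspec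
  set W := Module.End.eigenspace (T : E →ₗ[ℂ] E) l with hW
  have hCW : ∀ x ∈ W, (C : E →ₗ[ℂ] E) x ∈ W := by
    intro x hx
    rw [hW, Module.End.mem_eigenspace_iff] at hx ⊢
    have h1 : T (C x) = C (T x) := (DFunLike.congr_fun hTC.eq x).symm
    have h2 : T x = l • x := hx
    simp [h1, h2]
  have : Nontrivial W := Submodule.nontrivial_iff_ne_bot.mpr hev
  obtain ⟨c, hc⟩ := Module.End.exists_eigenvalue ((C : E →ₗ[ℂ] E).restrict hCW)
  obtain ⟨w, hw⟩ := hc.exists_hasEigenvector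
  refine ⟨w, l, c, ?_, ?_, ?_, hln'⟩
  · simpa using hw.2
  · exact Module.End.mem_eigenspace_iff.mp w.2
  · exact congrArg Subtype.val hw.apply_eq_smul

theorem inner_sum_mul_self {E ι : Type*} [NormedAddCommGroup E]
    [InnerProductSpace ℂ E] [CompleteSpace E] [Fintype ι] {D : ι → E →L[ℂ] E}
    (hD : ∀ i, IsSelfAdjoint (D i)) (v : E) :
    inner ℂ v ((∑ i, D i * D i) v) = ((∑ i, ‖D i v‖ ^ 2 : ℝ) : ℂ) := by
  rw [sum_apply, inner_sum]
  push_cast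
  refine Finset.sum_congr rfl fun i _ => ?_
  change inner ℂ v (D i (D i v)) = _
  rw [← ContinuousLinearMap.adjoint_inner_left,
    ← ContinuousLinearMap.star_eq_adjoint, (hD i).star_eq, inner_self_eq_norm_sq_to_K]
  rfl

/-- A spectral gap for alternating projections from a Casimir element `∑ i, D i * D i`. -/
theorem norm_proj_mul_proj_mul_proj_sub_le {E ι : Type*} [NormedAddCommGroup E]
    [InnerProductSpace ℂ E] [FiniteDimensional ℂ E] [CompleteSpace E] [Fintype ι] [DecidableEq ι]
    {A B H : E →L[ℂ] E} {D : ι → E →L[ℂ] E}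
    (hA : IsSelfAdjoint A) (hB : IsSelfAdjoint B) (hH : IsSelfAdjoint H)
    (hAA : A * A = A) (hBB : B * B = B) (hHH : H * H = H) (hAH : A * H = H) (hBH : B * H = H)
    (hD : ∀ i, IsSelfAdjoint (D i))
    (hCA : Commute (∑ i, D i * D i) A) (hCB : Commute (∑ i, D i * D i) B)
    (hCH : Commute (∑ i, D i * D i) H) (i₀ : ι) (hi₀ : D i₀ = 0) (S : Finset ι) (hS₀ : i₀ ∉ S)
    (hSB : ∀ i ∈ S, D i * B = 0)
    (hnorm : ∀ v, A v = v → ∀ i j, i ≠ i₀ → j ≠ i₀ → ‖D i v‖ = ‖D j v‖)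
    (hker : ∀ v, (∀ i, D i v = 0) → H v = v) (hι : 1 < Fintype.card ι) :
    ‖A * B * A - H‖ ≤ 1 - S.card / (Fintype.card ι - 1 : ℝ) := by
  have hm : (0 : ℝ) < Fintype.card ι - 1 := by
    have : (1 : ℝ) < Fintype.card ι := by exact_mod_cast hι
    linarith
  have hSm : (S.card : ℝ) ≤ Fintype.card ι - 1 := by
    have h1 : S ⊆ Finset.univ.erase i₀ := fun i hi =>
      Finset.mem_erase.mpr ⟨fun h => hS₀ (h ▸ hi), Finset.mem_univ i⟩
    have h2 := Finset.card_le_card h1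
    rw [Finset.card_erase_of_mem (Finset.mem_univ _), Finset.card_univ] at h2
    have h3 : ((Fintype.card ι - 1 : ℕ) : ℝ) = Fintype.card ι - 1 := by
      rw [Nat.cast_sub hι.le, Nat.cast_one]
    rw [← h3]
    exact_mod_cast h2
  have hHA : H * A = H := by
    simpa [hA.star_eq, hH.star_eq] using congrArg star hAH
  have hHB : H * B = H := by
    simpa [hB.star_eq, hH.star_eq] using congrArg star hBH
  set T := A * B * A - H with hTdef
  have hTsa : IsSelfAdjoint T := by
    rw [IsSelfAdjoint, hTdef, star_sub, star_mul, star_mul, hA.star_eq, hB.star_eq, hH.star_eq,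
      mul_assoc]
  by_cases hT0 : T = 0
  -- With no eigenvector available, the bound only has to be nonnegative, which is `hSm`.
  · rw [hT0, norm_zero, sub_nonneg, div_le_one hm]
    exact hSm
  have hCT : Commute (∑ i, D i * D i) T := ((hCA.mul_right hCB).mul_right hCA).sub_right hCH
  obtain ⟨v, l, c, hv0, hTv, hCv, hl⟩ := exists_common_eigenvector_norm_eq hTsa hT0 hCT
  have hl0 : l ≠ 0 := by
    rw [← norm_ne_zero_iff, hl]
    exact norm_ne_zero_iff.mpr hT0
  -- As `l ≠ 0`, the vector `v` lies in the range of `T`.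
  have fixed : ∀ F : E →L[ℂ] E, F * T = T → F v = v := by
    intro F hF
    have h1 : F (T v) = T v := DFunLike.congr_fun hF v
    rw [hTv, map_smul] at h1
    exact smul_right_injective E hl0 h1
  have hAv : A v = v := fixed A (by rw [hTdef, mul_sub, ← mul_assoc, ← mul_assoc, hAA, hAH])
  have hHv : H v = 0 := by
    have h0 : H * T = 0 := by
      rw [hTdef, mul_sub, ← mul_assoc, ← mul_assoc, hHA, hHB, hHA, hHH, sub_self]
    have h1 : H (T v) = 0 := DFunLike.congr_fun h0 v
    rw [hTv, map_smul] at h1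
    exact (smul_eq_zero.mp h1).resolve_left hl0
  have hinner : ∀ {F : E →L[ℂ] E}, IsSelfAdjoint F → ∀ x y : E,
      inner ℂ (F x) y = inner ℂ x (F y) := by
    intro F hF x y
    rw [← ContinuousLinearMap.adjoint_inner_left, ← ContinuousLinearMap.star_eq_adjoint,
      hF.star_eq]
  have hBn : inner ℂ v (B v) = (‖B v‖ : ℂ) ^ 2 := by
    have h1 : B v = B (B v) := (DFunLike.congr_fun hBB v).symm
    rw [h1, ← hinner hB, ← h1, inner_self_eq_norm_sq_to_K]
    rfl
  have hlv : l * (‖v‖ : ℂ) ^ 2 = (‖B v‖ : ℂ) ^ 2 := by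
    have h1 : inner ℂ v (T v) = inner ℂ v (B v) := by
      have : T v = A (B (A v)) - H v := rfl
      rw [this, hHv, hAv, sub_zero, ← hinner hA, hAv]
    rw [hTv, inner_smul_right, inner_self_eq_norm_sq_to_K, hBn] at h1
    exact h1
  have hvpos : 0 < ‖v‖ ^ 2 := by positivity
  have hTn : ‖T‖ * ‖v‖ ^ 2 = ‖B v‖ ^ 2 := by
    have := congrArg norm hlv
    simpa [hl] using this
  -- The component of `v` orthogonal to the range of `B`; it keeps the Casimir eigenvalue because
  -- `B` commutes with the Casimir element.
  set w := v - B v with hw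
  have hwn : ‖w‖ ^ 2 = ‖v‖ ^ 2 - ‖B v‖ ^ 2 := by
    have h1 := norm_sub_sq (𝕜 := ℂ) v (B v)
    rw [hBn] at h1
    have h2 : RCLike.re ((‖B v‖ : ℂ) ^ 2) = ‖B v‖ ^ 2 := by
      rw [← Complex.ofReal_pow]
      exact Complex.ofReal_re _
    rw [h2] at h1
    rw [hw, h1]
    ring
  have hCw : (∑ i, D i * D i) w = c • w := by
    have h1 : (∑ i, D i * D i) (B v) = B ((∑ i, D i * D i) v) := DFunLike.congr_fun hCB.eq v
    rw [hw, map_sub, h1, hCv, map_smul, smul_sub]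
  have hsum : ∀ x : E, (∑ i, D i * D i) x = c • x →
      c * (‖x‖ : ℂ) ^ 2 = ((∑ i, ‖D i x‖ ^ 2 : ℝ) : ℂ) := by
    intro x hx
    rw [← inner_sum_mul_self hD, hx, inner_smul_right, inner_self_eq_norm_sq_to_K]
    rfl
  have hre : ∀ x : E, (∑ i, D i * D i) x = c • x → c.re * ‖x‖ ^ 2 = ∑ i, ‖D i x‖ ^ 2 := by
    intro x hx
    have h1 := congrArg Complex.re (hsum x hx)
    rwa [← Complex.ofReal_pow, Complex.re_mul_ofReal, Complex.ofReal_re] at h1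
  have hcpos : 0 < c.re := by
    by_contra hneg
    have h1 : ∑ i, ‖D i v‖ ^ 2 ≤ 0 := by
      rw [← hre v hCv]
      exact mul_nonpos_of_nonpos_of_nonneg (not_lt.mp hneg) hvpos.le
    have h2 := (Finset.sum_eq_zero_iff_of_nonneg fun i _ => by positivity).mp
      (le_antisymm h1 (Finset.sum_nonneg fun i _ => by positivity))
    have h3 := hker v fun i => by simpa using h2 i (Finset.mem_univ i)
    exact hv0 (h3.symm.trans hHv)
  -- All terms but the vanishing one at `i₀` are equal, so the sum over `S` is the fraction `S.card
  -- / (card ι - 1)` of the whole.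
  have hcount : (S.card : ℝ) * (∑ i, ‖D i v‖ ^ 2) =
      (Fintype.card ι - 1 : ℝ) * ∑ i ∈ S, ‖D i v‖ ^ 2 := by
    rcases S.eq_empty_or_nonempty with rfl | ⟨s, hs⟩
    · simp
    have hs0 : s ≠ i₀ := fun h => hS₀ (h ▸ hs)
    have h1 : ∑ i ∈ S, ‖D i v‖ ^ 2 = S.card * ‖D s v‖ ^ 2 := by
      rw [← nsmul_eq_mul]
      refine Finset.sum_eq_card_nsmul fun i hi => ?_
      rw [hnorm v hAv i s (fun h => hS₀ (h ▸ hi)) hs0]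
    have h2 : ∑ i, ‖D i v‖ ^ 2 = (Fintype.card ι - 1 : ℝ) * ‖D s v‖ ^ 2 := by
      rw [← Finset.add_sum_erase _ _ (Finset.mem_univ i₀), hi₀]
      have h3 : ∑ i ∈ Finset.univ.erase i₀, ‖D i v‖ ^ 2 =
          (Finset.univ.erase i₀).card • ‖D s v‖ ^ 2 :=
        Finset.sum_eq_card_nsmul fun i hi => by
          rw [hnorm v hAv i s (Finset.ne_of_mem_erase hi) hs0]
      rw [h3, Finset.card_erase_of_mem (Finset.mem_univ _), Finset.card_univ, nsmul_eq_mul,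
        Nat.cast_sub hι.le]
      simp
    rw [h1, h2]
    ring
  have hSw : ∑ i ∈ S, ‖D i v‖ ^ 2 ≤ c.re * ‖w‖ ^ 2 := by
    rw [hre w hCw]
    calc ∑ i ∈ S, ‖D i v‖ ^ 2 = ∑ i ∈ S, ‖D i w‖ ^ 2 := by
          refine Finset.sum_congr rfl fun i hi => ?_
          have h1 : D i (B v) = 0 := DFunLike.congr_fun (hSB i hi) v
          rw [hw, map_sub, h1, sub_zero]
      _ ≤ ∑ i, ‖D i w‖ ^ 2 :=
          Finset.sum_le_sum_of_subset_of_nonneg (Finset.subset_univ S) fun i _ _ => by positivity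
  rw [le_sub_iff_add_le, ← le_sub_iff_add_le', div_le_iff₀ hm]
  have h5 : S.card * (c.re * ‖v‖ ^ 2) ≤
      (Fintype.card ι - 1 : ℝ) * (c.re * (‖v‖ ^ 2 - ‖T‖ * ‖v‖ ^ 2)) := by
    rw [hre v hCv, hcount, hTn, ← hwn]
    exact mul_le_mul_of_nonneg_left hSw hm.le
  have hpos : 0 < c.re * ‖v‖ ^ 2 := mul_pos hcpos hvpos
  refine le_of_mul_le_mul_right ?_ hpos
  calc S.card * (c.re * ‖v‖ ^ 2) ≤ _ := h5
    _ = _ := by ring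

/-! ### Operators acting on one tensor factor -/

/-- The matrix `X` acting on the tensor factor `j`. -/
def siteOp {τ κ : Type} [Fintype τ] [DecidableEq τ] [DecidableEq κ] (j : τ) (X : Matrix κ κ ℂ) :
    Matrix (τ → κ) (τ → κ) ℂ :=
  tensor (Function.update (fun _ => 1) j X)

section Site

variable {τ κ : Type} [Fintype τ] [DecidableEq τ] [DecidableEq κ]

theorem siteOp_apply (j : τ) (X : Matrix κ κ ℂ) (x y : τ → κ) :
    siteOp j X x y =
      X (x j) (y j) * ∏ k ∈ Finset.univ.erase j, (1 : Matrix κ κ ℂ) (x k) (y k) := by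
  rw [siteOp, tensor, Matrix.of_apply, ← Finset.mul_prod_erase _ _ (Finset.mem_univ j),
    Function.update_self]
  congr 1
  exact Finset.prod_congr rfl fun k hk => by rw [Function.update_of_ne (Finset.ne_of_mem_erase hk)]

theorem siteOp_add (j : τ) (X Y : Matrix κ κ ℂ) : siteOp j (X + Y) = siteOp j X + siteOp j Y := by
  ext x y
  simp only [siteOp_apply, Matrix.add_apply, add_mul]

theorem siteOp_smul (j : τ) (c : ℂ) (X : Matrix κ κ ℂ) : siteOp j (c • X) = c • siteOp j X := by
  ext x y
  simp only [siteOp_apply, Matrix.smul_apply, smul_eq_mul, mul_assoc]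

theorem siteOp_one (j : τ) : siteOp j (1 : Matrix κ κ ℂ) = 1 := by
  rw [siteOp, Function.update_eq_self j (fun _ => (1 : Matrix κ κ ℂ)), tensor_one]

theorem siteOp_mul [Fintype κ] (j : τ) (X Y : Matrix κ κ ℂ) :
    siteOp j X * siteOp j Y = siteOp j (X * Y) := by
  rw [siteOp, siteOp, tensor_mul, siteOp]
  congr 1
  funext k
  rcases eq_or_ne k j with rfl | h <;> simp [*]

theorem star_siteOp (j : τ) (X : Matrix κ κ ℂ) : star (siteOp j X) = siteOp j (star X) := by
  rw [siteOp, tensor_star, siteOp]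
  congr 1
  funext k
  rcases eq_or_ne k j with rfl | h
  · simp
  · rw [Function.update_of_ne h, Function.update_of_ne h]
    exact Matrix.conjTranspose_one

theorem siteOp_diagonal (j : τ) (d : κ → ℂ) :
    siteOp j (Matrix.diagonal d) = Matrix.diagonal fun x : τ → κ => d (x j) := by
  ext x y
  rw [siteOp_apply, Matrix.diagonal_apply, Matrix.diagonal_apply]
  rcases eq_or_ne x y with rfl | hxy
  · simp
  · rw [if_neg hxy]
    by_cases hj : x j = y j
    · obtain ⟨k, hk⟩ := Function.ne_iff.mp hxy
      have hkj : k ≠ j := fun h => hk (h ▸ hj)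
      have h0 : ∏ k ∈ Finset.univ.erase j, (1 : Matrix κ κ ℂ) (x k) (y k) = 0 :=
        Finset.prod_eq_zero (Finset.mem_erase.mpr ⟨hkj, Finset.mem_univ k⟩)
          (Matrix.one_apply_ne hk)
      rw [h0, mul_zero]
    · rw [if_neg hj, zero_mul]

theorem tensorPow_mul {κ : Type} [Fintype κ] (t : ℕ) (A B : Matrix κ κ ℂ) :
    tensorPow t A * tensorPow t B = tensorPow t (A * B) :=
  tensor_mul _ _

/-- Every factor other than `j` collapses to `U * V = 1`. -/
theorem tensorPow_mul_siteOp_mul [Fintype κ] {t : ℕ} (j : Fin t) {U V : Matrix κ κ ℂ}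
    (h : U * V = 1) (X : Matrix κ κ ℂ) :
    tensorPow t U * siteOp j X * tensorPow t V = siteOp j (U * X * V) := by
  rw [tensorPow, tensorPow, siteOp, tensor_mul, tensor_mul, siteOp]
  congr 1
  funext k
  rcases eq_or_ne k j with rfl | hk <;> simp [*]

theorem tensorPow_diagonal (t : ℕ) (d : κ → ℂ) :
    tensorPow t (Matrix.diagonal d) = Matrix.diagonal fun x : Fin t → κ => ∏ j, d (x j) := by
  ext x y
  rw [tensorPow, tensor, Matrix.of_apply, Matrix.diagonal_apply]
  rcases eq_or_ne x y with rfl | hxy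
  · simp
  · obtain ⟨k, hk⟩ := Function.ne_iff.mp hxy
    rw [if_neg hxy]
    exact Finset.prod_eq_zero (Finset.mem_univ k) (Matrix.diagonal_apply_ne _ hk)

end Site

/-! ### The representation `A ↦ A^{⊗t} ⊗ conj(A)^{⊗t}` and its infinitesimal version -/

section Mixed

variable {κ : Type}

/-- The mixed tensor power `A^{⊗t} ⊗ conj(A)^{⊗t}`. -/
def mixedPow (t : ℕ) (A : Matrix κ κ ℂ) :
    Matrix ((Fin t → κ) × (Fin t → κ)) ((Fin t → κ) × (Fin t → κ)) ℂ :=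
  tensorPow t A ⊗ₖ tensorPow t (A.map star)

theorem map_star_mul [Fintype κ] (A B : Matrix κ κ ℂ) :
    (A * B).map star = A.map star * B.map star := by
  ext i j
  simp [Matrix.mul_apply]

theorem mixedPow_mul [Fintype κ] (t : ℕ) (A B : Matrix κ κ ℂ) :
    mixedPow t (A * B) = mixedPow t A * mixedPow t B := by
  rw [mixedPow, map_star_mul, ← tensorPow_mul, ← tensorPow_mul, Matrix.mul_kronecker_mul]
  rfl

theorem mixedPow_one [DecidableEq κ] (t : ℕ) : mixedPow t (1 : Matrix κ κ ℂ) = 1 := by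
  have h : (1 : Matrix κ κ ℂ).map star = 1 := Matrix.map_one _ (star_zero _) (star_one _)
  rw [mixedPow, h, tensorPow, tensor_one, Matrix.one_kronecker_one]

theorem star_mixedPow (t : ℕ) (A : Matrix κ κ ℂ) :
    star (mixedPow t A) = mixedPow t (star A) := by
  rw [mixedPow, Matrix.star_eq_conjTranspose, Matrix.conjTranspose_kronecker,
    ← Matrix.star_eq_conjTranspose, ← Matrix.star_eq_conjTranspose, tensorPow, tensorPow,
    tensor_star, tensor_star]
  rfl

/-- The `t` factors `c` cancel the `t` factors `star c`; this is why the phase convention of the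
Clifford group is irrelevant. -/
theorem mixedPow_smul {t : ℕ} {c : ℂ} (hc : ‖c‖ = 1) (A : Matrix κ κ ℂ) :
    mixedPow t (c • A) = mixedPow t A := by
  have h1 : (c • A).map star = star c • A.map star := by
    ext i j
    simp
  rw [mixedPow, h1, tensorPow, tensorPow, tensor_smul, tensor_smul, Matrix.smul_kronecker,
    Matrix.kronecker_smul, smul_smul, Finset.prod_const, Finset.prod_const, ← mul_pow]
  have h2 : c * star c = 1 := by
    rw [Complex.star_def, Complex.mul_conj, Complex.normSq_eq_norm_sq, hc]
    simp
  rw [h2, one_pow, one_smul]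
  rfl

/-- The derivation `X ↦ ∑ j, X_j ⊗ 1 - 1 ⊗ (Xᵀ)_j` tangent to `mixedPow`. -/
def mixedDeriv [DecidableEq κ] (t : ℕ) : Matrix κ κ ℂ →ₗ[ℂ]
    Matrix ((Fin t → κ) × (Fin t → κ)) ((Fin t → κ) × (Fin t → κ)) ℂ where
  toFun X := ∑ j : Fin t, (siteOp j X ⊗ₖ (1 : Matrix (Fin t → κ) (Fin t → κ) ℂ) -
    (1 : Matrix (Fin t → κ) (Fin t → κ) ℂ) ⊗ₖ siteOp j Xᵀ)
  map_add' X Y := by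
    rw [← Finset.sum_add_distrib]
    refine Finset.sum_congr rfl fun j _ => ?_
    rw [Matrix.transpose_add, siteOp_add, siteOp_add, Matrix.add_kronecker, Matrix.kronecker_add]
    abel
  map_smul' c X := by
    rw [RingHom.id_apply, Finset.smul_sum]
    refine Finset.sum_congr rfl fun j _ => ?_
    rw [Matrix.transpose_smul, siteOp_smul, siteOp_smul, Matrix.smul_kronecker,
      Matrix.kronecker_smul, smul_sub]

theorem mixedDeriv_apply [DecidableEq κ] (t : ℕ) (X : Matrix κ κ ℂ) :
    mixedDeriv t X = ∑ j : Fin t, (siteOp j X ⊗ₖ (1 : Matrix (Fin t → κ) (Fin t → κ) ℂ) -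
      (1 : Matrix (Fin t → κ) (Fin t → κ) ℂ) ⊗ₖ siteOp j Xᵀ) :=
  rfl

theorem mixedDeriv_one [DecidableEq κ] (t : ℕ) : mixedDeriv t (1 : Matrix κ κ ℂ) = 0 := by
  simp [mixedDeriv_apply, siteOp_one]

theorem star_mixedDeriv [DecidableEq κ] (t : ℕ) (X : Matrix κ κ ℂ) :
    star (mixedDeriv t X) = mixedDeriv t (star X) := by
  rw [mixedDeriv_apply, mixedDeriv_apply, star_sum]
  refine Finset.sum_congr rfl fun j _ => ?_
  rw [star_sub, Matrix.star_eq_conjTranspose, Matrix.star_eq_conjTranspose,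
    Matrix.conjTranspose_kronecker, Matrix.conjTranspose_kronecker, Matrix.conjTranspose_one,
    ← Matrix.star_eq_conjTranspose, ← Matrix.star_eq_conjTranspose, star_siteOp, star_siteOp]
  rfl

/-- Equivariance under the adjoint action. On the conjugate factors, `V = star U` gives `U.map star
= Vᵀ` and `V.map star = Uᵀ`, so the transpose in `mixedDeriv` turns `X` into `(U * X * V)ᵀ`. -/
theorem mixedPow_mul_mixedDeriv_mul [Fintype κ] [DecidableEq κ] (t : ℕ)
    {U V : Matrix κ κ ℂ} (h : U * V = 1) (hV : V = star U) (X : Matrix κ κ ℂ) :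
    mixedPow t U * mixedDeriv t X * mixedPow t V = mixedDeriv t (U * X * V) := by
  have h' : U.map star * V.map star = 1 := by
    rw [← map_star_mul, h, Matrix.map_one _ (star_zero _) (star_one _)]
  have hT : U.map star * Xᵀ * V.map star = (U * X * V)ᵀ := by
    have h1 : U.map star = Vᵀ := by
      rw [hV]
      rfl
    have h2 : V.map star = Uᵀ := by
      rw [hV]
      ext i j
      simp [Matrix.star_apply]
    rw [h1, h2, Matrix.transpose_mul, Matrix.transpose_mul, mul_assoc]
  have h1 : tensorPow t U * tensorPow t V = 1 := by
    rw [tensorPow_mul, h, tensorPow, tensor_one]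
  have h2 : tensorPow t (U.map star) * tensorPow t (V.map star) = 1 := by
    rw [tensorPow_mul, h', tensorPow, tensor_one]
  rw [mixedDeriv_apply, mixedDeriv_apply, Finset.mul_sum, Finset.sum_mul]
  refine Finset.sum_congr rfl fun j _ => ?_
  rw [mul_sub, sub_mul, mixedPow, mixedPow, ← Matrix.mul_kronecker_mul,
    ← Matrix.mul_kronecker_mul, ← Matrix.mul_kronecker_mul, ← Matrix.mul_kronecker_mul,
    tensorPow_mul_siteOp_mul j h, tensorPow_mul_siteOp_mul j h', hT, mul_one, mul_one, h1, h2]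

theorem mixedPow_diagonal [DecidableEq κ] (t : ℕ) (d : κ → ℂ) :
    mixedPow t (Matrix.diagonal d) = Matrix.diagonal fun p : (Fin t → κ) × (Fin t → κ) =>
      (∏ j, d (p.1 j)) * ∏ j, star (d (p.2 j)) := by
  have h : (Matrix.diagonal d).map star = Matrix.diagonal fun i => star (d i) :=
    Matrix.diagonal_map (star_zero _)
  rw [mixedPow, h, tensorPow_diagonal, tensorPow_diagonal, Matrix.diagonal_kronecker_diagonal]

theorem mixedDeriv_diagonal [DecidableEq κ] (t : ℕ) (d : κ → ℂ) :
    mixedDeriv t (Matrix.diagonal d) = Matrix.diagonal fun p : (Fin t → κ) × (Fin t → κ) =>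
      ∑ j, (d (p.1 j) - d (p.2 j)) := by
  have h : ∀ j : Fin t, (siteOp j (Matrix.diagonal d) ⊗ₖ (1 : Matrix (Fin t → κ) (Fin t → κ) ℂ) -
      (1 : Matrix (Fin t → κ) (Fin t → κ) ℂ) ⊗ₖ siteOp j (Matrix.diagonal d)ᵀ) =
      Matrix.diagonal fun p : (Fin t → κ) × (Fin t → κ) => d (p.1 j) - d (p.2 j) := by
    intro j
    rw [Matrix.diagonal_transpose, siteOp_diagonal, ← Matrix.diagonal_one,
      Matrix.diagonal_kronecker_diagonal, Matrix.diagonal_kronecker_diagonal,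
      Matrix.diagonal_sub]
    simp
  simp only [mixedDeriv_apply, h]
  ext p q
  rw [Matrix.sum_apply]
  rcases eq_or_ne p q with rfl | hpq
  · simp
  · simp [Matrix.diagonal_apply_ne _ hpq]

theorem prod_exp_mul_prod_star_exp {t : ℕ} (d : κ → ℝ) (p : (Fin t → κ) × (Fin t → κ)) :
    (∏ j, Complex.exp (Complex.I * d (p.1 j))) * ∏ j, star (Complex.exp (Complex.I * d (p.2 j))) =
      Complex.exp (Complex.I * ∑ j, ((d (p.1 j) : ℂ) - d (p.2 j))) := by
  have h : ∀ x : ℝ, star (Complex.exp (Complex.I * x)) = Complex.exp (-(Complex.I * x)) := by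
    intro x
    rw [Complex.star_def, ← Complex.exp_conj]
    simp
  simp only [h, ← Complex.exp_sum, ← Complex.exp_add]
  congr 1
  rw [Finset.mul_sum, ← Finset.sum_add_distrib]
  exact Finset.sum_congr rfl fun j _ => by ring

/-- A vector killed by a real diagonal generator is fixed by its exponential. -/
theorem mixedPow_diagonal_exp_mulVec [Fintype κ] [DecidableEq κ] {t : ℕ} {d : κ → ℝ}
    {v : (Fin t → κ) × (Fin t → κ) → ℂ}
    (h : mixedDeriv t (Matrix.diagonal fun i => (d i : ℂ)) *ᵥ v = 0) :
    mixedPow t (Matrix.diagonal fun i => Complex.exp (Complex.I * d i)) *ᵥ v = v := by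
  funext p
  have hp := congrFun h p
  rw [mixedDeriv_diagonal, Matrix.mulVec_diagonal, Pi.zero_apply] at hp
  rw [mixedPow_diagonal, Matrix.mulVec_diagonal, prod_exp_mul_prod_star_exp]
  -- At each coordinate either the weight of the generator is zero, so the phase is 1, or `v`
  -- vanishes.
  rcases mul_eq_zero.mp hp with h0 | h0
  · simp [h0]
  · simp [h0]

/-- A matrix whose columns are fixed by a diagonal one-parameter group is killed by its
generator. -/
theorem mixedDeriv_diagonal_mul_eq_zero [Fintype κ] [DecidableEq κ] {t : ℕ} {ι : Type} {d : κ → ℝ}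
    {M : Matrix ((Fin t → κ) × (Fin t → κ)) ι ℂ}
    (h : ∀ s : ℝ, mixedPow t (Matrix.diagonal fun i => Complex.exp (Complex.I * (s * d i : ℝ))) * M
      = M) :
    mixedDeriv t (Matrix.diagonal fun i => (d i : ℂ)) * M = 0 := by
  ext p q
  rw [mixedDeriv_diagonal, Matrix.diagonal_mul, Matrix.zero_apply]
  set m : ℝ := ∑ j, (d (p.1 j) - d (p.2 j)) with hm
  have hmC : ∑ j, ((d (p.1 j) : ℂ) - d (p.2 j)) = m := by simp [hm]
  rw [hmC]
  by_cases hm0 : m = 0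
  · simp [hm0]
  -- At a coordinate of weight `m ≠ 0`, the time `π / m` produces the phase `-1`, so the entry
  -- equals its own negative. No differentiation is needed.
  have hs := congrFun (congrFun (h (Real.pi / m)) p) q
  have hpe := prod_exp_mul_prod_star_exp (fun i => Real.pi / m * d i) p
  beta_reduce at hpe
  rw [mixedPow_diagonal, Matrix.diagonal_mul, hpe] at hs
  have he : ∑ j, (((Real.pi / m * d (p.1 j) : ℝ) : ℂ) - (Real.pi / m * d (p.2 j) : ℝ)) =
      Real.pi := by
    have : ∑ j, (Real.pi / m * d (p.1 j) - Real.pi / m * d (p.2 j)) = Real.pi := by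
      simp only [← mul_sub, ← Finset.mul_sum, ← hm]
      field_simp
    exact_mod_cast congrArg Complex.ofReal this
  rw [he, mul_comm Complex.I, Complex.exp_pi_mul_I] at hs
  have : M p q = 0 := by linear_combination (-1 / 2 : ℂ) * hs
  rw [this, mul_zero]

end Mixed

/-! ### Diagonalisation of unitary matrices -/

section Diag

variable {κ : Type} [Fintype κ] [DecidableEq κ]

open scoped Matrix.Norms.L2Operator in
-- The logarithm is `arg` applied through the functional calculus: `arg` jumps on the negative axis,
-- but the spectrum is finite, so every function is continuous on it.
theorem exists_isHermitian_exp_eq (U : Matrix.unitaryGroup κ ℂ) :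
    ∃ H : Matrix κ κ ℂ, H.IsHermitian ∧ NormedSpace.exp (Complex.I • H) = U.1 := by
  refine ⟨cfc (Complex.ofReal ∘ Complex.arg : ℂ → ℂ) U.1, IsSelfAdjoint.cfc_arg U.1, ?_⟩
  have hfin := Matrix.finite_spectrum U.1
  have hn : IsStarNormal U.1 := by
    refine ⟨?_⟩
    rw [commute_iff_eq, Matrix.mem_unitaryGroup_iff.mp U.2, Matrix.mem_unitaryGroup_iff'.mp U.2]
  have hcont : ∀ f : ℂ → ℂ, ContinuousOn f (spectrum ℂ U.1) := fun f => hfin.continuousOn f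
  have hexp : NormedSpace.exp (Complex.I • cfc (Complex.ofReal ∘ Complex.arg : ℂ → ℂ) U.1) =
      cfc (fun z : ℂ => NormedSpace.exp (Complex.I • (Complex.arg z : ℂ))) U.1 := by
    have hs : Complex.I • cfc (Complex.ofReal ∘ Complex.arg : ℂ → ℂ) U.1 =
        cfc (fun z : ℂ => Complex.I • (Complex.arg z : ℂ)) U.1 :=
      (cfc_smul Complex.I _ U.1 (hcont _)).symm
    rw [hs]
    have hn2 : IsStarNormal (cfc (fun z : ℂ => Complex.I • (Complex.arg z : ℂ)) U.1) :=
      cfc_predicate _ _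
    rw [← CFC.exp_eq_normedSpace_exp (𝕜 := ℂ), ← cfc_comp' _ _ U.1 ?_ (hcont _)]
    exact (hfin.image _).continuousOn _
  rw [hexp]
  conv_rhs => rw [← cfc_id' ℂ U.1]
  refine cfc_congr fun z hz => ?_
  have hz1 : ‖z‖ = 1 := spectrum.norm_eq_one_of_unitary U.2 hz
  rw [← Complex.exp_eq_exp_ℂ, smul_eq_mul, mul_comm]
  have := Complex.norm_mul_exp_arg_mul_I z
  rwa [hz1, Complex.ofReal_one, one_mul] at this

theorem exists_unitary_diagonal_of_isHermitian {H : Matrix κ κ ℂ} (hH : H.IsHermitian) :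
    ∃ (W : Matrix.unitaryGroup κ ℂ) (d : κ → ℝ),
      H = W.1 * Matrix.diagonal (fun i => (d i : ℂ)) * star W.1 :=
  ⟨hH.eigenvectorUnitary, hH.eigenvalues, by
    conv_lhs => rw [hH.spectral_theorem]
    rfl⟩

theorem exists_unitary_diagonal_exp (U : Matrix.unitaryGroup κ ℂ) :
    ∃ (W : Matrix.unitaryGroup κ ℂ) (d : κ → ℝ),
      U.1 = W.1 * Matrix.diagonal (fun i => Complex.exp (Complex.I * d i)) * star W.1 := by
  obtain ⟨H, hH, hU⟩ := exists_isHermitian_exp_eq U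
  obtain ⟨W, d, hd⟩ := exists_unitary_diagonal_of_isHermitian hH
  refine ⟨W, d, ?_⟩
  have hinv : star W.1 = W.1⁻¹ :=
    (Matrix.inv_eq_right_inv (Matrix.mem_unitaryGroup_iff.mp W.2)).symm
  have hunit : IsUnit W.1 :=
    ⟨⟨W.1, star W.1, Matrix.mem_unitaryGroup_iff.mp W.2, Matrix.mem_unitaryGroup_iff'.mp W.2⟩, rfl⟩
  have hsm : Complex.I • H =
      W.1 * Matrix.diagonal (fun i => Complex.I * (d i : ℂ)) * W.1⁻¹ := by
    have h1 : Matrix.diagonal (fun i => Complex.I * (d i : ℂ)) =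
        Complex.I • Matrix.diagonal (fun i => (d i : ℂ)) := by
      ext i j
      by_cases hij : i = j <;> simp [hij]
    rw [hd, h1, Matrix.mul_smul, Matrix.smul_mul, hinv]
  rw [← hU, hsm, Matrix.exp_conj _ _ hunit, Matrix.exp_diagonal, ← hinv]
  congr 3
  funext i
  rw [Pi.coe_exp, Complex.exp_eq_exp_ℂ]

end Diag

/-! ### Casimir elements -/

section Casimir

variable {κ ι : Type} [Fintype κ] [DecidableEq κ] [Fintype ι]

/-- A family of matrices with `∑ i, X i ⊗ X i = N • SWAP`. -/
def IsSwapFamily (N : ℂ) (X : ι → Matrix κ κ ℂ) : Prop :=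
  ∀ a b c d, ∑ i, X i a b * X i c d = N * ((1 : Matrix κ κ ℂ) a d * (1 : Matrix κ κ ℂ) c b)

/-- `U ⊗ U` and `V ⊗ V` pass through the swap and meet as `U * V = 1`; the proof is this computation
in matrix entries. -/
theorem IsSwapFamily.conj {N : ℂ} {X : ι → Matrix κ κ ℂ} (hX : IsSwapFamily N X)
    {U V : Matrix κ κ ℂ} (hUV : U * V = 1) : IsSwapFamily N fun i => U * X i * V := by
  intro a b c d
  have key : ∀ i, (U * X i * V) a b * (U * X i * V) c d =
      ∑ f, ∑ e, ∑ h, ∑ g, U a g * V h b * U c e * V f d * (X i g h * X i e f) := by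
    intro i
    simp only [Matrix.mul_apply, Finset.sum_mul, Finset.mul_sum]
    refine Finset.sum_congr rfl fun f _ => Finset.sum_congr rfl fun e _ =>
      Finset.sum_congr rfl fun h _ => Finset.sum_congr rfl fun g _ => ?_
    ring
  simp only [key]
  have : ∑ i, ∑ f, ∑ e, ∑ h, ∑ g, U a g * V h b * U c e * V f d * (X i g h * X i e f) =
      ∑ f, ∑ e, ∑ h, ∑ g, U a g * V h b * U c e * V f d * ∑ i, (X i g h * X i e f) := by
    rw [Finset.sum_comm]
    refine Finset.sum_congr rfl fun f _ => ?_
    rw [Finset.sum_comm]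
    refine Finset.sum_congr rfl fun e _ => ?_
    rw [Finset.sum_comm]
    refine Finset.sum_congr rfl fun h _ => ?_
    rw [Finset.sum_comm]
    refine Finset.sum_congr rfl fun g _ => ?_
    rw [Finset.mul_sum]
  rw [this, ← hUV]
  simp only [hX _ _ _ _, Matrix.one_apply, Matrix.mul_apply, Finset.sum_mul, Finset.mul_sum]
  rw [Finset.sum_comm]
  refine Finset.sum_congr rfl fun f _ => Finset.sum_congr rfl fun e _ => ?_
  simp only [mul_ite, mul_one, mul_zero, Finset.sum_ite_eq', Finset.sum_ite_eq, Finset.mem_univ,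
    if_true, Finset.sum_const_zero, Finset.sum_ite_irrel]
  ring

/-- Both sides are the image of the same tensor `N • SWAP` under the linear map `Y ⊗ Z ↦ L Y * L Z`.
-/
theorem sum_map_mul_map_eq {R : Type*} [Ring R] [Algebra ℂ R] (L : Matrix κ κ ℂ →ₗ[ℂ] R)
    {N : ℂ} {X Y : ι → Matrix κ κ ℂ} (hX : IsSwapFamily N X) (hY : IsSwapFamily N Y) :
    ∑ i, L (X i) * L (X i) = ∑ i, L (Y i) * L (Y i) := by
  have expand : ∀ {Z : ι → Matrix κ κ ℂ}, IsSwapFamily N Z → ∑ i, L (Z i) * L (Z i) =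
      ∑ c, ∑ d, ∑ a, ∑ b, (N * ((1 : Matrix κ κ ℂ) a d * (1 : Matrix κ κ ℂ) c b)) •
        (L (Matrix.single a b 1) * L (Matrix.single c d 1)) := by
    intro Z hZ
    have h1 : ∀ i, L (Z i) = ∑ a, ∑ b, Z i a b • L (Matrix.single a b 1) := by
      intro i
      conv_lhs => rw [Matrix.matrix_eq_sum_single (Z i)]
      simp only [map_sum]
      refine Finset.sum_congr rfl fun a _ => Finset.sum_congr rfl fun b _ => ?_
      rw [← map_smul, Matrix.smul_single, smul_eq_mul, mul_one]
    simp only [← hZ _ _ _ _, Finset.sum_smul]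
    symm
    simp only [Finset.sum_comm (s := (Finset.univ : Finset κ)) (t := (Finset.univ : Finset ι))]
    refine Finset.sum_congr rfl fun i _ => ?_
    rw [h1 i]
    simp only [Finset.sum_mul, Finset.mul_sum, smul_mul_smul_comm]
  rw [expand hX, expand hY]

/-- Conjugating by `mixedPow t U` replaces each `X i` by `U * X i * star U`. This is a swap family
with the same `N`, so it has the same Casimir element. -/
theorem IsSwapFamily.commute_casimir {N : ℂ} {X : ι → Matrix κ κ ℂ} (hX : IsSwapFamily N X)
    (t : ℕ) (U : Matrix.unitaryGroup κ ℂ) :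
    Commute (∑ i, mixedDeriv t (X i) * mixedDeriv t (X i)) (mixedPow t U.1) := by
  have hUV := Matrix.mem_unitaryGroup_iff.mp U.2
  have hVU := Matrix.mem_unitaryGroup_iff'.mp U.2
  have h1 := sum_map_mul_map_eq (mixedDeriv t) (hX.conj hUV) hX
  have hinv : mixedPow t (star U.1) * mixedPow t U.1 = 1 := by
    rw [← mixedPow_mul, hVU, mixedPow_one]
  have h2 : ∀ i, mixedDeriv t (U.1 * X i * star U.1) * mixedDeriv t (U.1 * X i * star U.1) =
      mixedPow t U.1 * (mixedDeriv t (X i) * mixedDeriv t (X i)) * mixedPow t (star U.1) := by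
    intro i
    rw [← mixedPow_mul_mixedDeriv_mul t hUV rfl]
    calc _ = mixedPow t U.1 * mixedDeriv t (X i) * (mixedPow t (star U.1) * mixedPow t U.1) *
          mixedDeriv t (X i) * mixedPow t (star U.1) := by simp only [mul_assoc]
      _ = _ := by rw [hinv, mul_one]; simp only [mul_assoc]
  simp only [h2, ← Finset.mul_sum, ← Finset.sum_mul] at h1
  rw [commute_iff_eq]
  calc _ = mixedPow t U.1 * (∑ i, mixedDeriv t (X i) * mixedDeriv t (X i)) *
        (mixedPow t (star U.1) * mixedPow t U.1) := by
        rw [← mul_assoc, h1]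
    _ = _ := by rw [hinv, mul_one]

/-- A swap family spans all matrices. -/
theorem IsSwapFamily.eq_sum_smul {N : ℂ} (hN : N ≠ 0) {X : ι → Matrix κ κ ℂ}
    (hX : IsSwapFamily N X) (Y : Matrix κ κ ℂ) :
    Y = ∑ i, (N⁻¹ * ∑ a, ∑ b, Y a b * X i b a) • X i := by
  -- The coefficient of `X i` is `N⁻¹ * tr (Y * X i)`: contract the swap identity with `Y`.
  ext c d
  rw [Matrix.sum_apply]
  simp only [Matrix.smul_apply, smul_eq_mul, Finset.sum_mul, Finset.mul_sum]
  have : ∀ (a b : κ), ∑ i, N⁻¹ * (Y a b * X i b a) * X i c d =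
      Y a b * ((1 : Matrix κ κ ℂ) b d * (1 : Matrix κ κ ℂ) c a) := by
    intro a b
    have h := hX b a c d
    calc _ = N⁻¹ * Y a b * ∑ i, X i b a * X i c d := by
          rw [Finset.mul_sum]
          exact Finset.sum_congr rfl fun i _ => by ring
      _ = _ := by
          rw [h]
          field_simp
  rw [Finset.sum_comm]
  simp only [Finset.sum_comm (s := (Finset.univ : Finset ι)) (t := (Finset.univ : Finset κ)), this]
  simp [Matrix.one_apply]

/-- A vector killed by the derivation of a swap family is invariant under the unitary group. -/
theorem IsSwapFamily.mixedPow_mulVec {N : ℂ} (hN : N ≠ 0) {X : ι → Matrix κ κ ℂ}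
    (hX : IsSwapFamily N X) {t : ℕ} {v : (Fin t → κ) × (Fin t → κ) → ℂ}
    (hv : ∀ i, mixedDeriv t (X i) *ᵥ v = 0) (U : Matrix.unitaryGroup κ ℂ) :
    mixedPow t U.1 *ᵥ v = v := by
  have hall : ∀ Y : Matrix κ κ ℂ, mixedDeriv t Y *ᵥ v = 0 := by
    intro Y
    rw [hX.eq_sum_smul hN Y, map_sum, Matrix.sum_mulVec]
    refine Finset.sum_eq_zero fun i _ => ?_
    rw [map_smul, Matrix.smul_mulVec, hv i, smul_zero]
  -- After rotation by `star W` the problem is diagonal: the rotated vector is killed by the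
  -- diagonal generator, hence fixed by its exponential.
  obtain ⟨W, d, hU⟩ := exists_unitary_diagonal_exp U
  have hW := Matrix.mem_unitaryGroup_iff.mp W.2
  have hW' := Matrix.mem_unitaryGroup_iff'.mp W.2
  have hconj : mixedPow t W.1 * mixedPow t (star W.1) = 1 := by
    rw [← mixedPow_mul, hW, mixedPow_one]
  have h1 : mixedDeriv t (Matrix.diagonal fun i => (d i : ℂ)) *ᵥ (mixedPow t (star W.1) *ᵥ v)
      = 0 := by
    have h2 := mixedPow_mul_mixedDeriv_mul t hW' (star_star W.1).symm
      (W.1 * Matrix.diagonal (fun i => (d i : ℂ)) * star W.1)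
    have h3 : star W.1 * (W.1 * Matrix.diagonal (fun i => (d i : ℂ)) * star W.1) * W.1 =
        Matrix.diagonal (fun i => (d i : ℂ)) := by
      rw [mul_assoc, mul_assoc, hW', mul_one, ← mul_assoc, hW', one_mul]
    rw [← h3, ← h2, Matrix.mulVec_mulVec, mul_assoc, hconj, mul_one, ← Matrix.mulVec_mulVec, hall,
      Matrix.mulVec_zero]
  rw [hU, mixedPow_mul, mixedPow_mul, ← Matrix.mulVec_mulVec, ← Matrix.mulVec_mulVec,
    mixedPow_diagonal_exp_mulVec h1, Matrix.mulVec_mulVec, hconj, Matrix.one_mulVec]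

end Casimir

/-! ### Moment operators of Haar measures -/

section Moments

variable {n : ℕ}

instance isProbabilityMeasure_haarProb (G : Type) [Group G] [TopologicalSpace G]
    [IsTopologicalGroup G] [CompactSpace G] [MeasurableSpace G] [BorelSpace G] :
    IsProbabilityMeasure (haarProb G) :=
  ⟨Measure.haarMeasure_self⟩

instance isMulLeftInvariant_haarProb (G : Type) [Group G] [TopologicalSpace G]
    [IsTopologicalGroup G] [CompactSpace G] [MeasurableSpace G] [BorelSpace G] :
    (haarProb G).IsMulLeftInvariant :=
  inferInstanceAs (Measure.haarMeasure ⊤).IsMulLeftInvariant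

theorem momentOp_apply (ν : Measure (QubitUnitary n)) (t : ℕ)
    (x y : (Fin t → Fin n → Fin 2) × (Fin t → Fin n → Fin 2)) :
    momentOp ν t x y = ∫ U, mixedPow t U.1 x y ∂ν :=
  rfl

theorem continuous_mixedPow_apply (t : ℕ)
    (x y : (Fin t → Fin n → Fin 2) × (Fin t → Fin n → Fin 2)) :
    Continuous fun U : QubitUnitary n => mixedPow t U.1 x y := by
  have h : ∀ a b, Continuous fun U : QubitUnitary n => U.1 a b := fun a b =>
    (continuous_apply_apply a b).comp continuous_subtype_val
  have h' : (fun U : QubitUnitary n => mixedPow t U.1 x y) = fun U : QubitUnitary n =>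
      (∏ k, U.1 (x.1 k) (y.1 k)) * ∏ k, star (U.1 (x.2 k) (y.2 k)) := rfl
  rw [h']
  exact (continuous_finsetProd _ fun k _ => h _ _).mul
    (continuous_finsetProd _ fun k _ => (h _ _).star)

theorem integrable_of_continuous_of_compactSpace {X : Type*} [TopologicalSpace X] [CompactSpace X]
    [MeasurableSpace X] [BorelSpace X] (ν : Measure X) [IsFiniteMeasure ν]
    {f : X → ℂ} (hf : Continuous f) : Integrable f ν :=
  hf.integrable_of_hasCompactSupport (HasCompactSupport.of_compactSpace f)

theorem mul_momentOp_mul_apply {ι₁ ι₂ : Type*} (ν : Measure (QubitUnitary n)) [IsFiniteMeasure ν]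
    (t : ℕ) (A : Matrix ι₁ ((Fin t → Fin n → Fin 2) × (Fin t → Fin n → Fin 2)) ℂ)
    (B : Matrix ((Fin t → Fin n → Fin 2) × (Fin t → Fin n → Fin 2)) ι₂ ℂ) (x : ι₁) (y : ι₂) :
    (A * momentOp ν t * B) x y = ∫ U, (A * mixedPow t U.1 * B) x y ∂ν := by
  have hint : ∀ a b, Integrable (fun U : QubitUnitary n => mixedPow t U.1 a b) ν := fun a b =>
    integrable_of_continuous_of_compactSpace ν (continuous_mixedPow_apply t a b)
  simp only [Matrix.mul_apply, momentOp_apply, Finset.sum_mul]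
  rw [integral_finsetSum _ fun b _ => integrable_finsetSum _ fun a _ =>
    ((hint a b).const_mul _).mul_const _]
  refine Finset.sum_congr rfl fun b _ => ?_
  rw [integral_finsetSum _ fun a _ => ((hint a b).const_mul _).mul_const _]
  refine Finset.sum_congr rfl fun a _ => ?_
  rw [integral_mul_const, integral_const_mul]

/-- Fubini, together with the multiplicativity of `mixedPow`. -/
theorem momentOp_mconv (μ ν : Measure (QubitUnitary n)) [IsFiniteMeasure μ] [IsFiniteMeasure ν]
    (t : ℕ) : momentOp (μ ∗ₘ ν) t = momentOp μ t * momentOp ν t := by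
  ext x y
  rw [momentOp_apply, integral_mconv
    (integrable_of_continuous_of_compactSpace _ (continuous_mixedPow_apply t x y))]
  have h1 := mul_momentOp_mul_apply μ t 1 (momentOp ν t) x y
  rw [one_mul] at h1
  rw [h1]
  refine integral_congr_ae (Filter.Eventually.of_forall fun U => ?_)
  have h2 := mul_momentOp_mul_apply ν t (mixedPow t U.1) 1 x y
  rw [mul_one] at h2
  simp only [one_mul]
  rw [h2]
  refine integral_congr_ae (Filter.Eventually.of_forall fun V => ?_)
  simp only [mul_one, Submonoid.coe_mul, mixedPow_mul]

section Hom

variable {K : Type} [Group K] [TopologicalSpace K] [IsTopologicalGroup K] [CompactSpace K]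
  [MeasurableSpace K] [BorelSpace K] {φ : K →* QubitUnitary n}

theorem mul_momentOp_map_mul_apply (hφ : Continuous φ) {ι₁ ι₂ : Type*} (t : ℕ)
    (A : Matrix ι₁ ((Fin t → Fin n → Fin 2) × (Fin t → Fin n → Fin 2)) ℂ)
    (B : Matrix ((Fin t → Fin n → Fin 2) × (Fin t → Fin n → Fin 2)) ι₂ ℂ) (x : ι₁) (y : ι₂) :
    (A * momentOp ((haarProb K).map φ) t * B) x y =
      ∫ k, (A * mixedPow t (φ k).1 * B) x y ∂haarProb K := by
  have : IsProbabilityMeasure ((haarProb K).map φ) :=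
    Measure.isProbabilityMeasure_map hφ.measurable.aemeasurable
  rw [mul_momentOp_mul_apply, integral_map hφ.measurable.aemeasurable]
  refine Continuous.aestronglyMeasurable ?_
  simp only [Matrix.mul_apply]
  exact continuous_finsetSum _ fun b _ => (continuous_finsetSum _ fun a _ =>
    continuous_const.mul (continuous_mixedPow_apply t a b)).mul continuous_const

theorem mul_momentOp_map_mul_eq (hφ : Continuous φ) {ι₁ ι₂ : Type*} {t : ℕ}
    {A : Matrix ι₁ ((Fin t → Fin n → Fin 2) × (Fin t → Fin n → Fin 2)) ℂ}
    {B : Matrix ((Fin t → Fin n → Fin 2) × (Fin t → Fin n → Fin 2)) ι₂ ℂ} {C : Matrix ι₁ ι₂ ℂ}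
    (h : ∀ k, A * mixedPow t (φ k).1 * B = C) :
    A * momentOp ((haarProb K).map φ) t * B = C := by
  ext x y
  rw [mul_momentOp_map_mul_apply hφ]
  simp [h]

theorem mixedPow_mul_momentOp_map (hφ : Continuous φ) (t : ℕ) (k : K) :
    mixedPow t (φ k).1 * momentOp ((haarProb K).map φ) t = momentOp ((haarProb K).map φ) t := by
  ext x y
  have h1 := mul_momentOp_map_mul_apply hφ t (mixedPow t (φ k).1) 1 x y
  have h2 := mul_momentOp_map_mul_apply hφ t 1 1 x y
  simp only [mul_one, one_mul] at h1 h2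
  rw [h1, h2, ← integral_mul_left_eq_self (fun j => mixedPow t (φ j).1 x y) k]
  simp only [map_mul, Submonoid.coe_mul, mixedPow_mul]

theorem momentOp_map_mul_eq_of_forall (hφ : Continuous φ) {t : ℕ} {ι : Type*}
    {B : Matrix ((Fin t → Fin n → Fin 2) × (Fin t → Fin n → Fin 2)) ι ℂ}
    (h : ∀ k, mixedPow t (φ k).1 * B = B) : momentOp ((haarProb K).map φ) t * B = B := by
  have := mul_momentOp_map_mul_eq hφ (A := 1) (C := B) (B := B) (t := t)
    fun k => by rw [one_mul, h]
  rwa [one_mul] at this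

theorem momentOp_map_mul_self (hφ : Continuous φ) (t : ℕ) :
    momentOp ((haarProb K).map φ) t * momentOp ((haarProb K).map φ) t =
      momentOp ((haarProb K).map φ) t :=
  momentOp_map_mul_eq_of_forall hφ (mixedPow_mul_momentOp_map hφ t)

/-- Taking adjoints in the left invariance of `M` gives `star M * mixedPow t (φ k) = star M`;
averaging over `k` yields `star M * M = star M`, whose left side is self-adjoint. -/
theorem isSelfAdjoint_momentOp_map (hφ : Continuous φ) (t : ℕ) :
    IsSelfAdjoint (momentOp ((haarProb K).map φ) t) := by
  set M := momentOp ((haarProb K).map φ) t with hM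
  have h1 : star M * M * 1 = star M := by
    have := mul_momentOp_map_mul_eq hφ (A := star M) (B := 1) (C := star M) (t := t) fun k => by
      have h2 := congrArg star (mixedPow_mul_momentOp_map hφ t k⁻¹)
      rw [star_mul, star_mixedPow] at h2
      rw [mul_one]
      simpa using h2
    exact this
  rw [mul_one] at h1
  have h3 := congrArg star h1
  rw [star_mul, star_star, h1] at h3
  exact h3

theorem commute_momentOp_map (hφ : Continuous φ) {t : ℕ}
    {X : Matrix ((Fin t → Fin n → Fin 2) × (Fin t → Fin n → Fin 2))
      ((Fin t → Fin n → Fin 2) × (Fin t → Fin n → Fin 2)) ℂ}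
    (h : ∀ k, Commute X (mixedPow t (φ k).1)) : Commute X (momentOp ((haarProb K).map φ) t) := by
  rw [commute_iff_eq]
  ext x y
  have h1 := mul_momentOp_map_mul_apply hφ t X 1 x y
  have h2 := mul_momentOp_map_mul_apply hφ t 1 X x y
  simp only [mul_one, one_mul] at h1 h2
  rw [h1, h2]
  simp only [(h _).eq]

end Hom

end Moments

/-! ### Pauli strings -/

/-- The sign with which the Pauli matrices `a` and `b` commute. -/
def pauliSign (a b : Fin 4) : ℂ := if a = 0 ∨ b = 0 ∨ a = b then 1 else -1

theorem pauli_mul_comm (a b : Fin 4) : pauli a * pauli b = pauliSign a b • (pauli b * pauli a) := by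
  fin_cases a <;> fin_cases b <;> ext i j <;> fin_cases i <;> fin_cases j <;>
    simp [pauli, pauliSign, Matrix.mul_apply, Fin.sum_univ_two]

theorem pauliSign_eq (a b : Fin 4) : pauliSign a b = 1 ∨ pauliSign a b = -1 := by
  rw [pauliSign]
  split_ifs <;> simp

theorem pauliSign_zero_left (b : Fin 4) : pauliSign 0 b = 1 := by simp [pauliSign]

theorem pauliSign_zero_right (a : Fin 4) : pauliSign a 0 = 1 := by simp [pauliSign]

theorem exists_pauliSign_eq_neg_one {a b : Fin 4} (ha : a ≠ 0) (hb : b ≠ 0) :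
    ∃ c, pauliSign a c = -1 ∧ pauliSign b c = -1 := by
  have h : ∃ c : Fin 4, ¬ (a = 0 ∨ c = 0 ∨ a = c) ∧ ¬ (b = 0 ∨ c = 0 ∨ b = c) := by
    revert a b
    decide
  obtain ⟨c, h1, h2⟩ := h
  exact ⟨c, if_neg h1, if_neg h2⟩

theorem sum_pauli_mul_pauli (x y z w : Fin 2) : ∑ a, pauli a x y * pauli a z w =
    2 * ((1 : Matrix (Fin 2) (Fin 2) ℂ) x w * (1 : Matrix (Fin 2) (Fin 2) ℂ) z y) := by
  fin_cases x <;> fin_cases y <;> fin_cases z <;> fin_cases w <;>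
    simp [pauli, Fin.sum_univ_four] <;> norm_num

section Strings

variable {n : ℕ}

/-- The Pauli string `P₁ ⊗ ⋯ ⊗ Pₙ`. -/
def pauliString (a : Fin n → Fin 4) : Matrix (Fin n → Fin 2) (Fin n → Fin 2) ℂ :=
  tensor fun j => pauli (a j)

/-- The sign with which the Pauli strings `a` and `b` commute. -/
def stringSign (a b : Fin n → Fin 4) : ℂ := ∏ j, pauliSign (a j) (b j)

theorem pauliString_zero : pauliString (0 : Fin n → Fin 4) = 1 :=
  tensor_one

theorem star_pauliString (a : Fin n → Fin 4) : star (pauliString a) = pauliString a := by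
  simp only [pauliString, tensor_star, pauli_star]

theorem pauliString_mul_self (a : Fin n → Fin 4) : pauliString a * pauliString a = 1 := by
  simp only [pauliString, tensor_mul, pauli_mul_self, tensor_one]

theorem pauliString_mul_comm (a b : Fin n → Fin 4) :
    pauliString a * pauliString b = stringSign a b • (pauliString b * pauliString a) := by
  simp only [pauliString, stringSign, tensor_mul, ← tensor_smul, ← pauli_mul_comm]

theorem stringSign_eq (a b : Fin n → Fin 4) : stringSign a b = 1 ∨ stringSign a b = -1 := by
  rw [stringSign]
  refine Finset.prod_induction _ (fun z : ℂ => z = 1 ∨ z = -1) ?_ (Or.inl rfl)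
    fun j _ => pauliSign_eq _ _
  rintro x y (rfl | rfl) (rfl | rfl) <;> simp

theorem stringSign_update_left {a c : Fin n → Fin 4} {i : Fin n} (h : ∀ j ≠ i, c j = 0) :
    stringSign a c = pauliSign (a i) (c i) := by
  rw [stringSign]
  exact Finset.prod_eq_single i (fun j _ hj => by rw [h j hj, pauliSign_zero_right]) (by simp)

/-- Any two nontrivial Pauli strings anticommute with a common Pauli string. -/
theorem exists_stringSign_eq_neg_one {a b : Fin n → Fin 4} (ha : a ≠ 0) (hb : b ≠ 0) :
    ∃ c, stringSign a c = -1 ∧ stringSign b c = -1 := by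
  have single : ∀ {i : Fin n}, a i ≠ 0 → b i ≠ 0 →
      ∃ c, stringSign a c = -1 ∧ stringSign b c = -1 := by
    intro i hai hbi
    obtain ⟨c, h1, h2⟩ := exists_pauliSign_eq_neg_one hai hbi
    refine ⟨Pi.single i c, ?_, ?_⟩ <;>
      rw [stringSign_update_left (i := i) fun j hj => Pi.single_eq_of_ne hj _] <;> simpa
  obtain ⟨i, hi⟩ := Function.ne_iff.mp ha
  obtain ⟨j, hj⟩ := Function.ne_iff.mp hb
  rw [Pi.zero_apply] at hi hj
  by_cases hbi : b i = 0
  swap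
  · exact single hi hbi
  by_cases haj : a j = 0
  swap
  · exact single haj hj
  have hij : i ≠ j := fun h => hj (h ▸ hbi)
  obtain ⟨p, hp, -⟩ := exists_pauliSign_eq_neg_one hi hi
  obtain ⟨q, hq, -⟩ := exists_pauliSign_eq_neg_one hj hj
  -- Here `b` is trivial at `i` and `a` is trivial at `j`, so the factor at `i` only meets `a` and
  -- the factor at `j` only meets `b`.
  refine ⟨Function.update (Pi.single i p) j q, ?_, ?_⟩
  · rw [stringSign, Finset.prod_eq_single i]
    · rw [Function.update_of_ne hij, Pi.single_eq_same, hp]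
    · intro k _ hk
      rcases eq_or_ne k j with rfl | hkj
      · rw [haj, pauliSign_zero_left]
      · rw [Function.update_of_ne hkj, Pi.single_eq_of_ne hk, pauliSign_zero_right]
    · simp
  · rw [stringSign, Finset.prod_eq_single j]
    · rw [Function.update_self, hq]
    · intro k _ hk
      rcases eq_or_ne k i with rfl | hki
      · rw [hbi, pauliSign_zero_left]
      · rw [Function.update_of_ne hk, Pi.single_eq_of_ne hki, pauliSign_zero_right]
    · simp

/-- The sum over strings of products over qubits factorises into one single-qubit swap identity per
qubit, each contributing a factor 2. -/
theorem isSwapFamily_pauliString :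
    IsSwapFamily ((2 : ℂ) ^ n) (pauliString : (Fin n → Fin 4) → _) := by
  intro x y z w
  have h1 : ∀ u v : Fin n → Fin 2, (1 : Matrix (Fin n → Fin 2) (Fin n → Fin 2) ℂ) u v =
      ∏ j, (1 : Matrix (Fin 2) (Fin 2) ℂ) (u j) (v j) := by
    intro u v
    rw [← tensor_one]
    rfl
  simp only [pauliString, tensor, Matrix.of_apply, ← Finset.prod_mul_distrib]
  rw [h1 x w, h1 z y, ← Finset.prod_mul_distrib,
    ← Fintype.piFinset_univ,
    ← Finset.prod_univ_sum (fun _ : Fin n => (Finset.univ : Finset (Fin 4)))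
      fun j a => pauli a (x j) (y j) * pauli a (z j) (w j)]
  simp only [sum_pauli_mul_pauli, Finset.prod_mul_distrib, Finset.prod_const, Finset.card_univ,
    Fintype.card_fin]

theorem pauliString_single (i : Fin n) (b : Fin 4) :
    pauliString (Pi.single i b) = siteOp i (pauli b) := by
  rw [pauliString, siteOp]
  congr 1
  funext j
  rcases eq_or_ne j i with rfl | h
  · simp
  · rw [Pi.single_eq_of_ne h, Function.update_of_ne h]
    rfl

theorem pauliString_mem_unitaryGroup (a : Fin n → Fin 4) :
    pauliString a ∈ Matrix.unitaryGroup (Fin n → Fin 2) ℂ := by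
  rw [Matrix.mem_unitaryGroup_iff, star_pauliString, pauliString_mul_self]

theorem I_mem_gaussianRat : Complex.I ∈ gaussianRat :=
  Algebra.subset_adjoin rfl

theorem pauliString_apply_mem_gaussianRat (a : Fin n → Fin 4) (x y : Fin n → Fin 2) :
    pauliString a x y ∈ gaussianRat := by
  have h : ∀ (b : Fin 4) (u v : Fin 2), pauli b u v ∈ gaussianRat := by
    intro b u v
    have hI := I_mem_gaussianRat
    fin_cases b <;> fin_cases u <;> fin_cases v <;>
      simp [pauli, one_mem, zero_mem, hI]
  change ∏ j, pauli (a j) (x j) (y j) ∈ gaussianRat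
  exact prod_mem fun j _ => h _ _ _

/-- The scalar `(1 + i) / 2`, a Gaussian rational of absolute value `1 / √2`. -/
def halfPhase : ℂ := (1 + Complex.I) / 2

theorem halfPhase_mul_star : halfPhase * star halfPhase = 1 / 2 := by
  rw [halfPhase, Complex.star_def]
  simp only [map_div₀, map_add, map_one, Complex.conj_I, map_ofNat]
  linear_combination (-1 / 4 : ℂ) * Complex.I_sq

theorem halfPhase_mem_gaussianRat : halfPhase ∈ gaussianRat := by
  have h : halfPhase = algebraMap ℚ ℂ (1 / 2) * (1 + Complex.I) := by
    rw [halfPhase]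
    simp
    ring
  rw [h]
  exact mul_mem (gaussianRat.algebraMap_mem _) (add_mem (one_mem _) I_mem_gaussianRat)

/-- For anticommuting Pauli strings `P`, `Q`, the matrix `(1 + i) / 2 • (P + Q)` is a Clifford
unitary that conjugates `P` to `Q`. -/
theorem exists_clifford_conj {a b : Fin n → Fin 4} (hab : stringSign a b = -1) :
    ∃ U ∈ cliffordGroup n, U.1 * pauliString a * star U.1 = pauliString b := by
  set P := pauliString a with hP
  set Q := pauliString b with hQ
  have hPP : P * P = 1 := pauliString_mul_self a
  have hQQ : Q * Q = 1 := pauliString_mul_self b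
  have hPQ : P * Q = -(Q * P) := by
    rw [hP, hQ, pauliString_mul_comm, hab, neg_one_smul]
  have hstar : star (halfPhase • (P + Q)) = star halfPhase • (P + Q) := by
    rw [star_smul, star_add, hP, hQ, star_pauliString, star_pauliString]
  have hconj : ∀ R : Matrix (Fin n → Fin 2) (Fin n → Fin 2) ℂ,
      halfPhase • (P + Q) * R * star (halfPhase • (P + Q)) =
        (1 / 2 : ℂ) • ((P + Q) * R * (P + Q)) := by
    intro R
    rw [hstar, Matrix.smul_mul, Matrix.smul_mul, Matrix.mul_smul, smul_smul, halfPhase_mul_star]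
  -- By anticommutation `(P + Q)² = 2`. The usual normalisation `1 / √2` is not in `ℚ[i]`, hence the
  -- phase in `halfPhase`.
  have hmem : halfPhase • (P + Q) ∈ Matrix.unitaryGroup (Fin n → Fin 2) ℂ := by
    rw [Matrix.mem_unitaryGroup_iff]
    have h := hconj 1
    rw [mul_one] at h
    rw [h, mul_one, add_mul, mul_add, mul_add, hPP, hQQ, hPQ]
    have : (1 + -(Q * P) + (Q * P + 1) : Matrix (Fin n → Fin 2) (Fin n → Fin 2) ℂ) =
        (2 : ℂ) • 1 := by
      rw [two_smul]
      abel
    rw [this, smul_smul]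
    norm_num
  refine ⟨⟨_, hmem⟩, ⟨fun x y => ?_, ?_⟩, ?_⟩
  · exact mul_mem halfPhase_mem_gaussianRat
      (add_mem (pauliString_apply_mem_gaussianRat a x y) (pauliString_apply_mem_gaussianRat b x y))
  · intro R hR
    obtain ⟨k, c, hRc⟩ := hR
    have hsignP : P * R.1 = stringSign a c • (R.1 * P) := by
      rw [hRc, Matrix.mul_smul, Matrix.smul_mul, smul_comm]
      exact congrArg _ (pauliString_mul_comm a c)
    have hsignQ : Q * R.1 = stringSign b c • (R.1 * Q) := by
      rw [hRc, Matrix.mul_smul, Matrix.smul_mul, smul_comm]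
      exact congrArg _ (pauliString_mul_comm b c)
    set PU : QubitUnitary n := ⟨P, pauliString_mem_unitaryGroup a⟩
    set QU : QubitUnitary n := ⟨Q, pauliString_mem_unitaryGroup b⟩
    have hPU : PU ∈ pauliGroup n := ⟨0, a, by rw [pow_zero, one_smul]; rfl⟩
    have hQU : QU ∈ pauliGroup n := ⟨0, b, by rw [pow_zero, one_smul]; rfl⟩
    have finish : ∀ S ∈ pauliGroup n, ∀ s : ℂ, s = 1 ∨ s = -1 →
        (1 / 2 : ℂ) • ((P + Q) * R.1 * (P + Q)) = s • S.1 →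
        (⟨_, hmem⟩ * R * ⟨_, hmem⟩⁻¹ : QubitUnitary n) ∈ pauliGroup n := by
      rintro S ⟨l, d, hS⟩ s hs h
      have hval : (⟨_, hmem⟩ * R * ⟨_, hmem⟩⁻¹ : QubitUnitary n).1 = s • S.1 := by
        rw [← h, ← hconj]
        rfl
      rcases hs with rfl | rfl
      · exact ⟨l, d, by rw [hval, one_smul, hS]⟩
      · exact ⟨l + 2, d, by rw [hval, hS, smul_smul, pow_add, Complex.I_sq, mul_comm]⟩
    -- Equal signs leave `± R` and opposite signs leave `± R P Q` after halving; both are Pauli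
    -- group elements.
    have hexp : (P + Q) * R.1 * (P + Q) = (stringSign a c + stringSign b c) • R.1 +
        (stringSign a c - stringSign b c) • (R.1 * P * Q) := by
      have hQP : R.1 * Q * P = -(R.1 * P * Q) := by
        rw [mul_assoc, mul_assoc, hPQ, mul_neg, neg_neg]
      rw [add_mul, hsignP, hsignQ, add_mul, mul_add, mul_add, Matrix.smul_mul, Matrix.smul_mul,
        Matrix.smul_mul, Matrix.smul_mul, mul_assoc R.1 P P, hPP, mul_assoc R.1 Q Q, hQQ, mul_one,
        hQP, smul_neg, add_smul, sub_smul]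
      abel
    rcases stringSign_eq a c with h1 | h1 <;> rcases stringSign_eq b c with h2 | h2
    · refine finish R ⟨k, c, hRc⟩ 1 (Or.inl rfl) ?_
      rw [hexp, h1, h2, sub_self, zero_smul, add_zero, smul_smul]
      norm_num
    · refine finish (R * PU * QU) (mul_mem (mul_mem ⟨k, c, hRc⟩ hPU) hQU) 1 (Or.inl rfl) ?_
      rw [hexp, h1, h2, add_neg_cancel, zero_smul, zero_add, smul_smul]
      norm_num
      rfl
    · refine finish (R * PU * QU) (mul_mem (mul_mem ⟨k, c, hRc⟩ hPU) hQU) (-1) (Or.inr rfl) ?_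
      rw [hexp, h1, h2, neg_add_cancel, zero_smul, zero_add, smul_smul]
      norm_num
      rfl
    · refine finish R ⟨k, c, hRc⟩ (-1) (Or.inr rfl) ?_
      rw [hexp, h1, h2, sub_self, zero_smul, add_zero, smul_smul]
      norm_num
  · change halfPhase • (P + Q) * P * star (halfPhase • (P + Q)) = Q
    have hsum : (P + Q) * P * (P + Q) = (2 : ℂ) • Q := by
      have h1 : Q * P * Q = -P := by
        rw [mul_assoc, hPQ, mul_neg, ← mul_assoc, hQQ, one_mul]
      rw [add_mul, hPP, add_mul, one_mul, mul_add, mul_assoc Q P P, hPP, mul_one, h1, two_smul]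
      abel
    rw [hconj, hsum, smul_smul]
    norm_num

/-- Nontrivial Pauli strings are conjugate under the Clifford group. -/
theorem exists_clifford_conj_of_ne_zero {a b : Fin n → Fin 4} (ha : a ≠ 0) (hb : b ≠ 0) :
    ∃ U ∈ cliffordGroup n, U.1 * pauliString a * star U.1 = pauliString b := by
  -- Both strings are conjugated to a common `c` that anticommutes with each of them.
  obtain ⟨c, hac, hbc⟩ := exists_stringSign_eq_neg_one ha hb
  obtain ⟨U, hU, hUc⟩ := exists_clifford_conj hac
  obtain ⟨V, hV, hVc⟩ := exists_clifford_conj hbc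
  have hV' := Matrix.mem_unitaryGroup_iff'.mp V.2
  refine ⟨V⁻¹ * U, mul_mem (inv_mem hV) hU, ?_⟩
  rw [Submonoid.coe_mul, Matrix.UnitaryGroup.inv_val, star_mul, star_star]
  calc star V.1 * U.1 * pauliString a * (star U.1 * V.1)
      = star V.1 * (U.1 * pauliString a * star U.1) * V.1 := by simp only [mul_assoc]
    _ = (star V.1 * V.1) * pauliString b * (star V.1 * V.1) := by
        rw [hUc, ← hVc]
        simp only [mul_assoc]
    _ = pauliString b := by rw [hV', one_mul, mul_one]

end Strings

/-! ### Unitaries on one qubit -/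

section OnQubit

variable {n : ℕ}

/-- `onQubit i` as a group homomorphism. -/
def onQubitHom (i : Fin n) : Matrix.unitaryGroup (Fin 2) ℂ →* QubitUnitary n where
  toFun := onQubit i
  map_one' := Subtype.ext (siteOp_one i)
  map_mul' U V := Subtype.ext (siteOp_mul i U.1 V.1).symm

theorem continuous_onQubitHom (i : Fin n) : Continuous (onQubitHom i) := by
  refine Continuous.subtype_mk (continuous_matrix fun x y => ?_) _
  change Continuous fun V : Matrix.unitaryGroup (Fin 2) ℂ => siteOp i V.1 x y
  have h : ∀ a b, Continuous fun V : Matrix.unitaryGroup (Fin 2) ℂ => V.1 a b := fun a b =>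
    (continuous_apply_apply a b).comp continuous_subtype_val
  simp only [siteOp_apply]
  exact (h _ _).mul continuous_const

theorem diagonal_exp_mem_unitaryGroup {κ : Type} [Fintype κ] [DecidableEq κ] (d : κ → ℝ) :
    Matrix.diagonal (fun i => Complex.exp (Complex.I * d i)) ∈ Matrix.unitaryGroup κ ℂ := by
  rw [Matrix.mem_unitaryGroup_iff, Matrix.star_eq_conjTranspose, Matrix.diagonal_conjTranspose,
    Matrix.diagonal_mul_diagonal, ← Matrix.diagonal_one]
  congr 1
  funext i
  rw [Pi.star_apply, Complex.star_def, Complex.mul_conj, Complex.normSq_eq_norm_sq, mul_comm,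
    Complex.norm_exp_ofReal_mul_I]
  simp

/-- The Haar average over qubit `i` is killed by the generators acting on that qubit. -/
theorem mixedDeriv_siteOp_mul_momentOp (i : Fin n) (t : ℕ) {X : Matrix (Fin 2) (Fin 2) ℂ}
    (hX : X.IsHermitian) :
    mixedDeriv t (siteOp i X) * momentOp (singleQubitHaar i) t = 0 := by
  have hM : ∀ V : Matrix.unitaryGroup (Fin 2) ℂ,
      mixedPow t (siteOp i V.1) * momentOp (singleQubitHaar i) t =
        momentOp (singleQubitHaar i) t :=
    mixedPow_mul_momentOp_map (continuous_onQubitHom i) t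
  obtain ⟨W, d, hWd⟩ := exists_unitary_diagonal_of_isHermitian hX
  -- In an eigenbasis of `X` the generator is diagonal on all `n` qubits, with entries depending
  -- only on `x i`, and its one-parameter group acts on qubit `i` alone.
  have hdiag : mixedDeriv t (Matrix.diagonal fun x : Fin n → Fin 2 => (d (x i) : ℂ)) *
      momentOp (singleQubitHaar i) t = 0 := by
    refine mixedDeriv_diagonal_mul_eq_zero (d := fun x : Fin n → Fin 2 => d (x i)) fun s => ?_
    have h := hM ⟨_, diagonal_exp_mem_unitaryGroup fun j => s * d j⟩
    rwa [siteOp_diagonal] at h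
  have hsite : siteOp i X = siteOp i W.1 *
      (Matrix.diagonal fun x : Fin n → Fin 2 => (d (x i) : ℂ)) * star (siteOp i W.1) := by
    rw [← siteOp_diagonal i fun j => (d j : ℂ), star_siteOp, siteOp_mul, siteOp_mul, ← hWd]
  have hW : siteOp i W.1 * star (siteOp i W.1) = 1 := by
    rw [star_siteOp, siteOp_mul, Matrix.mem_unitaryGroup_iff.mp W.2, siteOp_one]
  have hMW : mixedPow t (star (siteOp i W.1)) * momentOp (singleQubitHaar i) t =
      momentOp (singleQubitHaar i) t := by
    rw [star_siteOp]
    exact hM (star W)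
  rw [hsite, ← mixedPow_mul_mixedDeriv_mul t hW rfl, mul_assoc, hMW, mul_assoc, hdiag, mul_zero]

end OnQubit

/-! ### The spectral gap of the auxiliary walk -/

section Gap

variable {n : ℕ}

theorem momentOp_map_mulVec_of_forall {K : Type} [Group K] [TopologicalSpace K]
    [IsTopologicalGroup K] [CompactSpace K] [MeasurableSpace K] [BorelSpace K]
    {φ : K →* QubitUnitary n} (hφ : Continuous φ) {t : ℕ}
    {v : (Fin t → Fin n → Fin 2) × (Fin t → Fin n → Fin 2) → ℂ}
    (h : ∀ k, mixedPow t (φ k).1 *ᵥ v = v) : momentOp ((haarProb K).map φ) t *ᵥ v = v := by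
  have h1 := momentOp_map_mul_eq_of_forall hφ (B := Matrix.replicateCol Unit v) (t := t) fun k => by
    rw [← Matrix.replicateCol_mulVec, h]
  rw [← Matrix.replicateCol_mulVec] at h1
  exact Matrix.replicateCol_injective h1

theorem norm_toEuclideanCLM_mixedPow_apply {κ : Type} [Fintype κ] [DecidableEq κ] (t : ℕ)
    (U : Matrix.unitaryGroup κ ℂ) (v : EuclideanSpace ℂ ((Fin t → κ) × (Fin t → κ))) :
    ‖Matrix.toEuclideanCLM (𝕜 := ℂ) (mixedPow t U.1) v‖ = ‖v‖ := by
  refine ContinuousLinearMap.norm_map_of_mem_unitary ?_ v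
  refine Unitary.map_mem Matrix.toEuclideanCLM ?_
  rw [Unitary.mem_iff, star_mixedPow, ← mixedPow_mul, ← mixedPow_mul,
    Matrix.mem_unitaryGroup_iff.mp U.2, Matrix.mem_unitaryGroup_iff'.mp U.2, mixedPow_one]
  exact ⟨rfl, rfl⟩

/-- The average over a group that is the Clifford group up to phases is invariant under the
Clifford group. -/
theorem mixedPow_mul_momentOp_uniformMeasure (t : ℕ) {G : Subgroup (QubitUnitary n)}
    [CompactSpace G] (hG : EqModPhases G (cliffordGroup n)) {U : QubitUnitary n}
    (hU : U ∈ cliffordGroup n) :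
    mixedPow t U.1 * momentOp (uniformMeasure G) t = momentOp (uniformMeasure G) t := by
  obtain ⟨V, hV, c, hc⟩ := hG.2 U hU
  rw [hc, mixedPow_smul (Circle.norm_coe c)]
  exact mixedPow_mul_momentOp_map (φ := G.subtype) continuous_subtype_val t ⟨V, hV⟩

/-- For a Clifford `U` taking `a` to `b`, equivariance writes the generator of `b` as a conjugate of
that of `a`. The inner `mixedPow t (star U)` fixes `v` and the outer `mixedPow t U` is unitary. -/
theorem norm_mixedDeriv_pauliString_eq (t : ℕ) {G : Subgroup (QubitUnitary n)}
    [CompactSpace G] (hG : EqModPhases G (cliffordGroup n)) {a b : Fin n → Fin 4} (ha : a ≠ 0)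
    (hb : b ≠ 0) {v : EuclideanSpace ℂ ((Fin t → Fin n → Fin 2) × (Fin t → Fin n → Fin 2))}
    (hv : Matrix.toEuclideanCLM (𝕜 := ℂ) (momentOp (uniformMeasure G) t) v = v) :
    ‖Matrix.toEuclideanCLM (𝕜 := ℂ) (mixedDeriv t (pauliString a)) v‖ =
      ‖Matrix.toEuclideanCLM (𝕜 := ℂ) (mixedDeriv t (pauliString b)) v‖ := by
  obtain ⟨U, hU, hUab⟩ := exists_clifford_conj_of_ne_zero ha hb
  have hinv : Matrix.toEuclideanCLM (𝕜 := ℂ) (mixedPow t (star U.1)) v = v := by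
    have h := mixedPow_mul_momentOp_uniformMeasure t hG (inv_mem hU)
    rw [Matrix.UnitaryGroup.inv_val] at h
    have h1 := DFunLike.congr_fun (congrArg (Matrix.toEuclideanCLM (𝕜 := ℂ)) h) v
    rw [map_mul] at h1
    change Matrix.toEuclideanCLM (𝕜 := ℂ) (mixedPow t (star U.1))
      (Matrix.toEuclideanCLM (𝕜 := ℂ) (momentOp (uniformMeasure G) t) v) = _ at h1
    rwa [hv] at h1
  have h2 := mixedPow_mul_mixedDeriv_mul t (Matrix.mem_unitaryGroup_iff.mp U.2) rfl (pauliString a)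
  rw [hUab] at h2
  rw [← h2, map_mul, map_mul]
  change _ = ‖Matrix.toEuclideanCLM (𝕜 := ℂ) (mixedPow t U.1)
    (Matrix.toEuclideanCLM (𝕜 := ℂ) (mixedDeriv t (pauliString a))
      (Matrix.toEuclideanCLM (𝕜 := ℂ) (mixedPow t (star U.1)) v))‖
  rw [hinv, norm_toEuclideanCLM_mixedPow_apply]

/-- The spectral gap of the auxiliary walk, with the constant `3` in place of `3 / 2`. -/
theorem momentGap_auxWalk_le (t : ℕ) (hn : 1 ≤ n) {G : Subgroup (QubitUnitary n)} [CompactSpace G]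
    (hG : EqModPhases G (cliffordGroup n)) :
    momentGap (auxWalk hn G) t ≤ 1 - 3 / ((4 : ℝ) ^ n - 1) := by
  have hGc : Continuous G.subtype := continuous_subtype_val
  have hQc := continuous_onQubitHom (⟨0, hn⟩ : Fin n)
  have hHc : Continuous (MonoidHom.id (QubitUnitary n)) := continuous_id
  -- The full Haar measure is written as a pushforward, so that the lemmas on homomorphisms cover
  -- all three measures.
  have hHid : (haarProb (QubitUnitary n)).map (MonoidHom.id (QubitUnitary n)) =
      haarProb (QubitUnitary n) := Measure.map_id
  have hGm : uniformMeasure G = (haarProb G).map G.subtype := rfl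
  have hQm : singleQubitHaar (⟨0, hn⟩ : Fin n) =
      (haarProb (Matrix.unitaryGroup (Fin 2) ℂ)).map (onQubitHom ⟨0, hn⟩) := rfl
  have hGp : IsProbabilityMeasure (uniformMeasure G) := by
    rw [hGm]
    exact Measure.isProbabilityMeasure_map hGc.measurable.aemeasurable
  have hQp : IsProbabilityMeasure (singleQubitHaar (⟨0, hn⟩ : Fin n)) := by
    rw [hQm]
    exact Measure.isProbabilityMeasure_map hQc.measurable.aemeasurable
  have hHinv : ∀ U : QubitUnitary n, mixedPow t U.1 * momentOp (haarProb (QubitUnitary n)) t =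
      momentOp (haarProb (QubitUnitary n)) t := by
    have h := mixedPow_mul_momentOp_map hHc t
    rwa [hHid] at h
  have hswap := isSwapFamily_pauliString (n := n)
  have hcas : ∀ M, Commute (∑ a : Fin n → Fin 4,
        mixedDeriv t (pauliString a) * mixedDeriv t (pauliString a)) M →
      Commute (∑ a : Fin n → Fin 4, Matrix.toEuclideanCLM (𝕜 := ℂ) (mixedDeriv t (pauliString a)) *
        Matrix.toEuclideanCLM (𝕜 := ℂ) (mixedDeriv t (pauliString a)))
        (Matrix.toEuclideanCLM (𝕜 := ℂ) M) := by
    intro M hM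
    have h := hM.map (Matrix.toEuclideanCLM (𝕜 := ℂ))
    simpa only [map_sum, map_mul] using h
  -- The nontrivial Pauli strings supported on the first qubit; their number 3 is the numerator of
  -- the gap.
  set S : Finset (Fin n → Fin 4) :=
    (Finset.univ.erase (0 : Fin 4)).image (Pi.single (⟨0, hn⟩ : Fin n)) with hS
  have hScard : S.card = 3 := by
    rw [hS, Finset.card_image_of_injective _ (Pi.single_injective _),
      Finset.card_erase_of_mem (Finset.mem_univ _)]
    rfl
  have hcard : Fintype.card (Fin n → Fin 4) = 4 ^ n := by simp
  have hmul : ∀ M N : Matrix ((Fin t → Fin n → Fin 2) × (Fin t → Fin n → Fin 2))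
      ((Fin t → Fin n → Fin 2) × (Fin t → Fin n → Fin 2)) ℂ, M * N = N →
      Matrix.toEuclideanCLM (𝕜 := ℂ) M * Matrix.toEuclideanCLM (𝕜 := ℂ) N =
        Matrix.toEuclideanCLM (𝕜 := ℂ) N := fun M N h => by rw [← map_mul, h]
  have key := norm_proj_mul_proj_mul_proj_sub_le
    (A := Matrix.toEuclideanCLM (𝕜 := ℂ) (momentOp (uniformMeasure G) t))
    (B := Matrix.toEuclideanCLM (𝕜 := ℂ) (momentOp (singleQubitHaar (⟨0, hn⟩ : Fin n)) t))
    (H := Matrix.toEuclideanCLM (𝕜 := ℂ) (momentOp (haarProb (QubitUnitary n)) t))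
    (D := fun a : Fin n → Fin 4 =>
      Matrix.toEuclideanCLM (𝕜 := ℂ) (mixedDeriv t (pauliString a)))
    ((isSelfAdjoint_momentOp_map hGc t).map _) ((isSelfAdjoint_momentOp_map hQc t).map _)
    (by
      have h := isSelfAdjoint_momentOp_map hHc t
      rw [hHid] at h
      exact h.map _)
    (hmul _ _ (momentOp_map_mul_self hGc t)) (hmul _ _ (momentOp_map_mul_self hQc t))
    (by
      have h := momentOp_map_mul_self hHc t
      rw [hHid] at h
      exact hmul _ _ h)
    (hmul _ _ (momentOp_map_mul_eq_of_forall hGc fun k => hHinv _))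
    (hmul _ _ (momentOp_map_mul_eq_of_forall hQc fun k => hHinv _))
    (fun a => by
      have h : IsSelfAdjoint (mixedDeriv t (pauliString a)) := by
        rw [IsSelfAdjoint, star_mixedDeriv, star_pauliString]
      exact h.map _)
    (hcas _ (commute_momentOp_map hGc fun k => hswap.commute_casimir t _))
    (hcas _ (commute_momentOp_map hQc fun k => hswap.commute_casimir t _))
    (by
      have h := commute_momentOp_map hHc fun k => hswap.commute_casimir t k
      rw [hHid] at h
      exact hcas _ h)
    0 (by rw [pauliString_zero, mixedDeriv_one, map_zero]) S
    (by
      intro h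
      obtain ⟨b, hb, hb0⟩ := Finset.mem_image.mp h
      refine Finset.ne_of_mem_erase hb ?_
      simpa using congrFun hb0 (⟨0, hn⟩ : Fin n))
    (by
      intro a ha
      obtain ⟨b, -, rfl⟩ := Finset.mem_image.mp ha
      rw [← map_mul, pauliString_single, mixedDeriv_siteOp_mul_momentOp _ _ (pauli_star b),
        map_zero])
    (fun v hv a b ha hb => norm_mixedDeriv_pauliString_eq t hG ha hb hv)
    (by
      intro v hv
      have h1 : ∀ a : Fin n → Fin 4, mixedDeriv t (pauliString a) *ᵥ v.ofLp = 0 := fun a =>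
        congrArg WithLp.ofLp (hv a)
      have h2 := momentOp_map_mulVec_of_forall hHc
        fun U => hswap.mixedPow_mulVec (pow_ne_zero n two_ne_zero) h1 U
      rw [hHid] at h2
      exact congrArg (WithLp.toLp 2) h2)
    (by
      rw [hcard]
      exact Nat.one_lt_pow (by omega) (by norm_num))
  rw [hScard, hcard] at key
  push_cast at key
  rw [momentGap, schattenInfNorm, auxWalk, momentOp_mconv, momentOp_mconv, ← mul_assoc, map_sub,
    map_mul, map_mul]
  exact key

end Gap

end

theorem lemma3 (t n : ℕ) (ht : 1 ≤ t) (hn : 1 ≤ n)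
    (G : Subgroup (QubitUnitary n)) [CompactSpace G] (hG : EqModPhases G (cliffordGroup n)) :
    momentGap (auxWalk hn G) t ≤ 1 - 3 / 2 * (1 / ((2 : ℝ) ^ (2 * n) - 1)) := by
  -- The bound just proved has twice the required gap; what remains is `2 ^ (2 * n) = 4 ^ n` and `3
  -- / 2 ≤ 3`.
  refine (momentGap_auxWalk_le t hn hG).trans ?_
  have h4 : (2 : ℝ) ^ (2 * n) = 4 ^ n := by
    rw [pow_mul]
    norm_num
  have hpos : (0 : ℝ) < 4 ^ n - 1 := sub_pos.mpr (one_lt_pow₀ (by norm_num) (by omega))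
  rw [h4, mul_one_div]
  exact sub_le_sub_left (div_le_div_of_nonneg_right (by norm_num) hpos.le) 1
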